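/- For a real random variable $W$ with finite, nonzero variance let $$\delta_W=\sup\Big\{\big|\textstyle\int h\,d\mu-\int h\,d\nu\big| : h:\mathbb R\to\mathbb R,\ |h(x)-h(y)|\le|x-y|\ \text{for all }x,y\Big\}$$ be the Kantorovich–Wasserstein distance between the law $\mu$ of $(W-\mathbb E W)/\sqrt{\operatorname{Var}W}$ and the standard Gaussian law $\nu$. There is a universal constant $C>0$ such that the following holds for every integer $n\ge 2$ and every real $\alpha$ such that $\alpha n$ is an integer with $\alpha n\ge 2$. Drop $n$ balls into $\alpha n$ boxes so that all $(\alpha n)^n$ possibilities are equally likely, and let $W$ be the number of empty boxes. Then $$\delta_W\le \frac{C f(\alpha)}{\sqrt n},\qquad f(\alpha)=\big(\alpha e^{-1/\alpha}-(1+\alpha)e^{-2/\alpha}\big)^{-3/2}.$$ -/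

import Mathlib

open MeasureTheory ProbabilityTheory
open scoped ENNReal

/-- The Kantorovich-Wasserstein distance of two Borel probability measures on the real line with
finite first moments: the supremum of `|∫ h dμ - ∫ h dν|` over all `1`-Lipschitz functions `h`.
The supremum is taken in `[0, ∞]`, so it is never a junk value. -/
noncomputable def kantorovichDist (μ ν : Measure ℝ) : ℝ≥0∞ :=
  ⨆ (h : ℝ → ℝ) (_ : LipschitzWith 1 h), ENNReal.ofReal |(∫ x, h x ∂μ) - ∫ x, h x ∂ν|

/-- The distance to normality of a real random variable `W` with finite, nonzero variance:
the Kantorovich-Wasserstein distance between the law of `(W - E W) / √(Var W)` and the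
standard Gaussian law. -/
noncomputable def normalDist {Ω : Type*} [MeasurableSpace Ω] (P : Measure Ω) (W : Ω → ℝ) :
    ℝ≥0∞ :=
  kantorovichDist
    (P.map fun ω => (W ω - ∫ ω', W ω' ∂P) / Real.sqrt (variance W P))
    (gaussianReal 0 1)

/-- The law of dropping `n` balls into `m` boxes: the uniform distribution on all `m ^ n`
configurations `x`, where `x i` is the box of ball `i`. -/
noncomputable def occupancyMeasure (n m : ℕ) : Measure (Fin n → Fin m) :=
  uniformOn Set.univ

/-- The number of empty boxes in the configuration `x`. -/
def emptyBoxes {n m : ℕ} (x : Fin n → Fin m) : ℕ :=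
  (Finset.univ.filter fun b : Fin m => ∀ i : Fin n, x i ≠ b).card

/-- `f(α) = (α e^{-1/α} - (1 + α) e^{-2/α})^{-3/2}`; the base is positive for `α > 0`. -/
noncomputable def occupancyFactor (α : ℝ) : ℝ :=
  (α * Real.exp (-1 / α) - (1 + α) * Real.exp (-2 / α)) ^ (-(3 / 2) : ℝ)

/-! Stein's method with a size-bias coupling. For a 1-Lipschitz `h` let `f` solve `f' x = x f x + h
x - ∫ h dν`; `exists_stein_solution` bounds `f'` and its Lipschitz constant by 15. With `Z = (W -
μ)/σ`, the task is to bound `E f'(Z) - E Z f(Z)`.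

Each box is empty with probability `ρ = (1 - 1/m)^n`, and rethrowing the balls of box `b` uniformly
into the other boxes turns the uniform configuration into one conditioned to avoid `b`. Hence
(`expect_emptyBoxes_mul`) the covariance of `W` with `G` is `ρ` times the mean total change of `G`
when each box is emptied in turn. Taking `G = f(Z)` and expanding to first order,
`stein_sizeBias_bound` leaves two errors: the fluctuation of the drift `D` (the mean change of `W`
given the configuration, summed over boxes), and a Taylor remainder governed by the squared box
loads.

The drift has an explicit form with bounded differences, so the Efron–Stein inequality gives `E|D -
E D| = O(√n (1 + n/m))`; the loads have binomial moments. As `ρ (1 + n/m) ≤ 1` and `σ ≤ √n`, the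
total is at most `90 n/σ³` (`abs_expect_sub_gaussian_le`).

Finally `f(α) = g^(-3/2)`, where `n g` is the asymptotic variance and `σ² ≥ n g - 2`
(`variance_emptyBoxes_lower`). If `n g ≥ 4` then `σ² ≥ n g/2`, which suffices; otherwise the claimed
bound exceeds the trivial bound 2. -/

/-! ### Gaussian tails and the Mills ratio -/

lemma integrable_gaussian_pow (j : ℕ) :
    Integrable (fun t : ℝ => t ^ j * Real.exp (-(1 / 2) * t ^ 2)) := by
  have h := integrable_rpow_mul_exp_neg_mul_sq (b := 1 / 2) (by norm_num) (s := (j : ℝ))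
    (lt_of_lt_of_le (by norm_num) (Nat.cast_nonneg j))
  simpa [Real.rpow_natCast] using h

lemma integrable_gaussian_zero : Integrable (fun t : ℝ => Real.exp (-(1 / 2) * t ^ 2)) := by
  simpa using integrable_gaussian_pow 0

lemma integrable_gaussian_one :
    Integrable (fun t : ℝ => t * Real.exp (-(1 / 2) * t ^ 2)) := by
  simpa using integrable_gaussian_pow 1

lemma hasDerivAt_gaussian (t : ℝ) :
    HasDerivAt (fun t : ℝ => Real.exp (-(1 / 2) * t ^ 2))
      (-(t * Real.exp (-(1 / 2) * t ^ 2))) t := by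
  have h := (((hasDerivAt_id t).pow 2).const_mul (-(1 / 2) : ℝ)).exp
  convert! h using 1
  simp; ring

lemma integral_Ioi_mul_gaussian (x : ℝ) :
    ∫ t in Set.Ioi x, t * Real.exp (-(1 / 2) * t ^ 2) = Real.exp (-(1 / 2) * x ^ 2) := by
  have hd : ∀ t ∈ Set.Ici x, HasDerivAt (fun t : ℝ => -Real.exp (-(1 / 2) * t ^ 2))
      (t * Real.exp (-(1 / 2) * t ^ 2)) t := fun t _ => by
    convert! (hasDerivAt_gaussian t).neg using 1
    simp
  -- The boundary term vanishes because the function and its derivative are both integrable on the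
  -- half-line.
  have hlim : Filter.Tendsto (fun t : ℝ => -Real.exp (-(1 / 2) * t ^ 2)) Filter.atTop
      (nhds 0) := by
    have := tendsto_zero_of_hasDerivAt_of_integrableOn_Ioi (a := x)
      (fun t ht => hd t (Set.mem_Ici_of_Ioi ht)) integrable_gaussian_one.integrableOn
      integrable_gaussian_zero.neg.integrableOn
    exact this
  rw [integral_Ioi_of_hasDerivAt_of_tendsto' hd integrable_gaussian_one.integrableOn hlim]
  simp

lemma integral_Ioi_sq_mul_gaussian (x : ℝ) :
    ∫ t in Set.Ioi x, t ^ 2 * Real.exp (-(1 / 2) * t ^ 2) =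
      x * Real.exp (-(1 / 2) * x ^ 2) + ∫ t in Set.Ioi x, Real.exp (-(1 / 2) * t ^ 2) := by
  have hd : ∀ t ∈ Set.Ici x, HasDerivAt (fun t : ℝ => -(t * Real.exp (-(1 / 2) * t ^ 2)))
      (t ^ 2 * Real.exp (-(1 / 2) * t ^ 2) - Real.exp (-(1 / 2) * t ^ 2)) t := fun t _ => by
    have := ((hasDerivAt_id t).mul (hasDerivAt_gaussian t)).neg
    convert! this using 1
    simp; ring
  have hint : IntegrableOn (fun t : ℝ => t ^ 2 * Real.exp (-(1 / 2) * t ^ 2) -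
      Real.exp (-(1 / 2) * t ^ 2)) (Set.Ioi x) :=
    ((integrable_gaussian_pow 2).sub integrable_gaussian_zero).integrableOn
  have hlim := tendsto_zero_of_hasDerivAt_of_integrableOn_Ioi (a := x)
      (fun t ht => hd t (Set.mem_Ici_of_Ioi ht)) hint integrable_gaussian_one.neg.integrableOn
  have h := integral_Ioi_of_hasDerivAt_of_tendsto' hd hint hlim
  rw [integral_sub (integrable_gaussian_pow 2).integrableOn
    integrable_gaussian_zero.integrableOn] at h
  linarith

/-- The Mills ratio of the standard Gaussian. -/
noncomputable def millsRatio (x : ℝ) : ℝ :=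
  Real.exp (1 / 2 * x ^ 2) * ∫ t in Set.Ioi x, Real.exp (-(1 / 2) * t ^ 2)

lemma exp_mul_gaussian (x : ℝ) :
    Real.exp (1 / 2 * x ^ 2) * Real.exp (-(1 / 2) * x ^ 2) = 1 := by
  rw [← Real.exp_add]; simp

lemma millsRatio_nonneg (x : ℝ) : 0 ≤ millsRatio x :=
  mul_nonneg (Real.exp_pos _).le (integral_nonneg fun _ => (Real.exp_pos _).le)

lemma integral_Ioi_sub_mul_gaussian (x : ℝ) :
    ∫ t in Set.Ioi x, (t - x) * Real.exp (-(1 / 2) * t ^ 2) =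
      Real.exp (-(1 / 2) * x ^ 2) - x * ∫ t in Set.Ioi x, Real.exp (-(1 / 2) * t ^ 2) := by
  simp_rw [sub_mul]
  rw [integral_sub integrable_gaussian_one.integrableOn
    (integrable_gaussian_zero.const_mul x).integrableOn, integral_Ioi_mul_gaussian,
    integral_const_mul]

lemma mul_millsRatio_le_one (x : ℝ) : x * millsRatio x ≤ 1 := by
  have h : 0 ≤ ∫ t in Set.Ioi x, (t - x) * Real.exp (-(1 / 2) * t ^ 2) :=
    setIntegral_nonneg measurableSet_Ioi fun t ht =>
      mul_nonneg (sub_nonneg.2 (le_of_lt ht)) (Real.exp_pos _).le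
  rw [integral_Ioi_sub_mul_gaussian] at h
  have h2 := mul_nonneg (Real.exp_pos (1 / 2 * x ^ 2)).le h
  rw [mul_sub, exp_mul_gaussian] at h2
  unfold millsRatio
  nlinarith

/-- Expand `∫ (t - x)² e^(-t²/2) ≥ 0` over the tail. This second-order Mills bound is what keeps `x²
(1 - x M)` bounded, hence `f'` Lipschitz. -/
lemma mul_one_sub_mul_millsRatio_le (x : ℝ) :
    x * (1 - x * millsRatio x) ≤ millsRatio x := by
  have h : 0 ≤ ∫ t in Set.Ioi x, (t - x) ^ 2 * Real.exp (-(1 / 2) * t ^ 2) :=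
    integral_nonneg fun t => mul_nonneg (sq_nonneg _) (Real.exp_pos _).le
  have e : ∀ t : ℝ, (t - x) ^ 2 * Real.exp (-(1 / 2) * t ^ 2) =
      t ^ 2 * Real.exp (-(1 / 2) * t ^ 2) - (2 * x) * (t * Real.exp (-(1 / 2) * t ^ 2)) +
        x ^ 2 * Real.exp (-(1 / 2) * t ^ 2) := fun t => by ring
  simp_rw [e] at h
  have hi : IntegrableOn (fun t : ℝ => t ^ 2 * Real.exp (-(1 / 2) * t ^ 2) -
      (2 * x) * (t * Real.exp (-(1 / 2) * t ^ 2))) (Set.Ioi x) :=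
    ((integrable_gaussian_pow 2).sub (integrable_gaussian_one.const_mul _)).integrableOn
  rw [integral_add hi (integrable_gaussian_zero.const_mul _).integrableOn,
    integral_sub (integrable_gaussian_pow 2).integrableOn
      (integrable_gaussian_one.const_mul _).integrableOn,
    integral_const_mul, integral_const_mul, integral_Ioi_mul_gaussian,
    integral_Ioi_sq_mul_gaussian] at h
  have h2 := mul_nonneg (Real.exp_pos (1 / 2 * x ^ 2)).le h
  have h3 := exp_mul_gaussian x
  unfold millsRatio
  set I := ∫ t in Set.Ioi x, Real.exp (-(1 / 2) * t ^ 2)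
  set a := Real.exp (1 / 2 * x ^ 2)
  set b := Real.exp (-(1 / 2) * x ^ 2)
  have : a * (x * b + I - 2 * x * b + x ^ 2 * I) = a * I - x * (a * b) + x ^ 2 * (a * I) := by
    ring
  rw [this, h3] at h2
  linarith

lemma millsRatio_le {x : ℝ} (hx : 0 ≤ x) : millsRatio x ≤ 5 := by
  rcases le_total 1 x with h1 | h1
  · have := mul_millsRatio_le_one x
    nlinarith [millsRatio_nonneg x]
  · have hI : ∫ t in Set.Ioi x, Real.exp (-(1 / 2) * t ^ 2) ≤ 2.6 := by
      calc ∫ t in Set.Ioi x, Real.exp (-(1 / 2) * t ^ 2)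
          ≤ ∫ t : ℝ, Real.exp (-(1 / 2) * t ^ 2) :=
            setIntegral_le_integral integrable_gaussian_zero
              (Filter.Eventually.of_forall fun t => (Real.exp_pos _).le)
        _ = √(Real.pi / (1 / 2)) := integral_gaussian (1 / 2)
        _ ≤ 2.6 := by
            rw [Real.sqrt_le_left (by norm_num)]
            have := Real.pi_lt_d2
            norm_num at this ⊢; linarith
    have hE : Real.exp (1 / 2 * x ^ 2) ≤ 1.75 := by
      have h2 : Real.exp (1 / 2 * x ^ 2) ≤ Real.exp (1 / 2) :=
        Real.exp_le_exp.2 (by nlinarith)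
      have h3 : Real.exp (1 / 2) ^ 2 = Real.exp 1 := by rw [← Real.exp_nat_mul]; norm_num
      have h4 := Real.exp_one_lt_d9
      have : Real.exp (1 / 2) ≤ 1.75 := by
        nlinarith [Real.exp_pos (1 / 2)]
      linarith
    have h0 : 0 ≤ ∫ t in Set.Ioi x, Real.exp (-(1 / 2) * t ^ 2) :=
      integral_nonneg fun _ => (Real.exp_pos _).le
    unfold millsRatio
    calc _ ≤ (1.75 : ℝ) * 2.6 := mul_le_mul hE hI h0 (by norm_num)
      _ ≤ 5 := by norm_num

/-! ### The Stein equation for Lipschitz functions -/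

lemma LipschitzWith.abs_sub_le {k : ℝ → ℝ} (hk : LipschitzWith 1 k) (x y : ℝ) :
    |k x - k y| ≤ |x - y| := by
  simpa [Real.dist_eq] using hk.dist_le_mul x y

lemma LipschitzWith.integrable_mul_gaussian {k : ℝ → ℝ} (hk : LipschitzWith 1 k) :
    Integrable (fun t : ℝ => k t * Real.exp (-(1 / 2) * t ^ 2)) := by
  refine Integrable.mono' (g := fun t : ℝ => |k 0| * Real.exp (-(1 / 2) * t ^ 2) +
    |t * Real.exp (-(1 / 2) * t ^ 2)|)
    ((integrable_gaussian_zero.const_mul _).add integrable_gaussian_one.abs) ?_ ?_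
  · have := hk.continuous
    exact (by fun_prop : Continuous fun t : ℝ => k t * Real.exp (-(1 / 2) * t ^ 2)
      ).aestronglyMeasurable
  · refine Filter.Eventually.of_forall fun t => ?_
    have h := hk.abs_sub_le t 0
    have h2 := abs_sub_abs_le_abs_sub (k t) (k 0)
    rw [sub_zero] at h
    rw [Real.norm_eq_abs, abs_mul, abs_mul, Real.abs_exp]
    nlinarith [Real.exp_pos (-(1 / 2) * t ^ 2)]

/-- `e^{x²/2}` times the Gaussian tail integral of `k`. -/
noncomputable def gaussianTail (k : ℝ → ℝ) (x : ℝ) : ℝ :=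
  Real.exp (1 / 2 * x ^ 2) * ∫ t in Set.Ioi x, k t * Real.exp (-(1 / 2) * t ^ 2)

/-- Replacing `k t` by `k x` in the tail integral costs at most the tail integral of `t - x`. -/
lemma abs_gaussianTail_sub_le {k : ℝ → ℝ} (hk : LipschitzWith 1 k) (x : ℝ) :
    |gaussianTail k x - k x * millsRatio x| ≤ 1 - x * millsRatio x := by
  have h1 : (∫ t in Set.Ioi x, k t * Real.exp (-(1 / 2) * t ^ 2)) -
      k x * ∫ t in Set.Ioi x, Real.exp (-(1 / 2) * t ^ 2) =
      ∫ t in Set.Ioi x, (k t - k x) * Real.exp (-(1 / 2) * t ^ 2) := by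
    simp_rw [sub_mul]
    rw [integral_sub hk.integrable_mul_gaussian.integrableOn
      (integrable_gaussian_zero.const_mul _).integrableOn, integral_const_mul]
  have h2 : |∫ t in Set.Ioi x, (k t - k x) * Real.exp (-(1 / 2) * t ^ 2)| ≤
      ∫ t in Set.Ioi x, (t - x) * Real.exp (-(1 / 2) * t ^ 2) := by
    rw [← Real.norm_eq_abs]
    refine norm_integral_le_of_norm_le ?_ ?_
    · simp_rw [sub_mul]
      exact (integrable_gaussian_one.sub (integrable_gaussian_zero.const_mul x)).integrableOn
    · refine (ae_restrict_iff' measurableSet_Ioi).2 (Filter.Eventually.of_forall fun t ht => ?_)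
      rw [Real.norm_eq_abs, abs_mul, Real.abs_exp]
      have h := hk.abs_sub_le t x
      rw [abs_of_pos (sub_pos.2 (Set.mem_Ioi.1 ht))] at h
      exact mul_le_mul_of_nonneg_right h (Real.exp_pos _).le
  rw [← h1, integral_Ioi_sub_mul_gaussian] at h2
  have h3 := mul_le_mul_of_nonneg_left h2 (Real.exp_pos (1 / 2 * x ^ 2)).le
  rw [← abs_of_pos (Real.exp_pos (1 / 2 * x ^ 2)), ← abs_mul,
    abs_of_pos (Real.exp_pos (1 / 2 * x ^ 2)), mul_sub, mul_sub, exp_mul_gaussian] at h3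
  unfold gaussianTail millsRatio
  rw [mul_left_comm _ (k x), mul_left_comm _ x] at h3
  exact h3

/-- With `f = -gaussianTail k`, the two quantities are `f'` and `(x f)'`. Both reduce to the Mills
inequalities after writing the tail as `k x * M + R` with `|R| ≤ 1 - x M`. -/
lemma gaussianTail_bounds {k : ℝ → ℝ} (hk : LipschitzWith 1 k) (h0 : |k 0| ≤ 1) {x : ℝ}
    (hx : 0 ≤ x) :
    |k x - x * gaussianTail k x| ≤ 15 ∧
      |x * (k x - x * gaussianTail k x) - gaussianTail k x| ≤ 14 := by
  have hkx : |k x| ≤ 1 + x := by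
    have h := hk.abs_sub_le x 0
    have h2 := abs_sub_abs_le_abs_sub (k x) (k 0)
    rw [sub_zero, abs_of_nonneg hx] at h
    linarith
  have hd := abs_gaussianTail_sub_le hk x
  have hM0 := millsRatio_nonneg x
  have hM1 := mul_millsRatio_le_one x
  have hM2 := mul_one_sub_mul_millsRatio_le x
  have hM5 := millsRatio_le hx
  set M := millsRatio x
  set T := gaussianTail k x
  obtain ⟨N, hN⟩ : ∃ N, N = 1 - x * M := ⟨_, rfl⟩
  obtain ⟨R, hR⟩ : ∃ R, R = T - k x * M := ⟨_, rfl⟩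
  rw [← hN] at hd hM2
  rw [← hR] at hd
  have hN0 : 0 ≤ N := by linarith
  have hN1 : N ≤ 1 := by nlinarith
  have e1 : k x - x * T = k x * N - x * R := by
    rw [hN]; linear_combination x * hR
  have e2 : T = k x * M + R := by linarith
  have b1 : |k x - x * T| ≤ (1 + 2 * x) * N := by
    rw [e1]
    calc |k x * N - x * R| ≤ |k x * N| + |x * R| := abs_sub _ _
      _ = |k x| * N + x * |R| := by rw [abs_mul, abs_mul, abs_of_nonneg hN0, abs_of_nonneg hx]
      _ ≤ (1 + x) * N + x * N := by gcongr
      _ = _ := by ring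
  have b2 : |T| ≤ (1 + x) * M + N := by
    rw [e2]
    calc |k x * M + R| ≤ |k x * M| + |R| := abs_add_le _ _
      _ = |k x| * M + |R| := by rw [abs_mul, abs_of_nonneg hM0]
      _ ≤ _ := by gcongr
  have hxx : x * (x * N) ≤ 1 := (mul_le_mul_of_nonneg_left hM2 hx).trans hM1
  refine ⟨by linarith, ?_⟩
  calc |x * (k x - x * T) - T| ≤ |x * (k x - x * T)| + |T| := abs_sub _ _
    _ = x * |k x - x * T| + |T| := by rw [abs_mul, abs_of_nonneg hx]
    _ ≤ x * ((1 + 2 * x) * N) + ((1 + x) * M + N) := by gcongr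
    -- The terms `x N`, `2 x² N`, `M`, `x M`, `N` contribute at most 5, 2, 5, 1, 1.
    _ ≤ 14 := by nlinarith

/-! ### Integrals of Lipschitz functions and the Stein solution. -/

lemma integral_gaussianReal_zero_one (k : ℝ → ℝ) :
    ∫ t, k t ∂(gaussianReal 0 1) =
      (√(2 * Real.pi))⁻¹ * ∫ t, k t * Real.exp (-(1 / 2) * t ^ 2) := by
  rw [integral_gaussianReal_eq_integral_smul one_ne_zero, ← integral_const_mul]
  refine integral_congr_ae (Filter.Eventually.of_forall fun t => ?_)
  simp only [gaussianPDFReal, smul_eq_mul, NNReal.coe_one, sub_zero, mul_one]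
  rw [show -t ^ 2 / 2 = -(1 / 2) * t ^ 2 by ring]
  ring

lemma integrable_id_gaussianReal : Integrable (fun t : ℝ => t) (gaussianReal 0 1) :=
  (memLp_id_gaussianReal (μ := 0) (v := 1) 1).integrable le_rfl

lemma LipschitzWith.integrable_of_integrable_id {μ : Measure ℝ} [IsProbabilityMeasure μ]
    (hμ : Integrable (fun t : ℝ => t) μ) {h : ℝ → ℝ} (hh : LipschitzWith 1 h) :
    Integrable h μ := by
  refine Integrable.mono' (g := fun t => |h 0| + |t|) ((integrable_const _).add hμ.abs)
    hh.continuous.aestronglyMeasurable (Filter.Eventually.of_forall fun t => ?_)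
  have h1 := hh.abs_sub_le t 0
  have h2 := abs_sub_abs_le_abs_sub (h t) (h 0)
  rw [sub_zero] at h1
  rw [Real.norm_eq_abs]
  linarith

/-- A Lipschitz function deviates from its value at `0` by at most one on average, under a law
with second moment at most one. -/
lemma LipschitzWith.abs_integral_sub_le_one {μ : Measure ℝ} [IsProbabilityMeasure μ]
    (hμ : Integrable (fun t : ℝ => t) μ) (hμ2 : Integrable (fun t : ℝ => t ^ 2) μ)
    (h1 : ∫ t, t ^ 2 ∂μ ≤ 1) {h : ℝ → ℝ} (hh : LipschitzWith 1 h) :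
    |(∫ t, h t ∂μ) - h 0| ≤ 1 := by
  have e : (∫ t, h t ∂μ) - h 0 = ∫ t, (h t - h 0) ∂μ := by
    rw [integral_sub (hh.integrable_of_integrable_id hμ) (integrable_const _)]; simp
  rw [e, ← Real.norm_eq_abs]
  calc _ ≤ ∫ t, (1 + t ^ 2) / 2 ∂μ := by
        refine norm_integral_le_of_norm_le (((integrable_const 1).add hμ2).div_const 2)
          (Filter.Eventually.of_forall fun t => ?_)
        have := hh.abs_sub_le t 0
        rw [sub_zero] at this
        rw [Real.norm_eq_abs]
        nlinarith [sq_nonneg (|t| - 1), sq_abs t]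
    _ ≤ 1 := by
        rw [integral_div, integral_add (integrable_const 1) hμ2]
        simp; linarith

lemma integrable_sq_gaussianReal : Integrable (fun t : ℝ => t ^ 2) (gaussianReal 0 1) :=
  (memLp_id_gaussianReal (μ := 0) (v := 1) 2).integrable_sq

lemma integral_sq_gaussianReal : ∫ t, t ^ 2 ∂(gaussianReal 0 1) = 1 := by
  have h := variance_id_gaussianReal (μ := 0) (v := 1)
  rw [variance_eq_integral aemeasurable_id] at h
  simpa [integral_id_gaussianReal] using h

theorem exists_stein_solution {h : ℝ → ℝ} (hh : LipschitzWith 1 h) :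
    ∃ f f' : ℝ → ℝ, (∀ x, HasDerivAt f (f' x) x) ∧
      (∀ x, f' x = x * f x + (h x - ∫ t, h t ∂(gaussianReal 0 1))) ∧
      (∀ x, |f' x| ≤ 15) ∧ ∀ x y, |f' x - f' y| ≤ 15 * |x - y| := by
  obtain ⟨c, hc⟩ : ∃ c, c = ∫ t, h t ∂(gaussianReal 0 1) := ⟨_, rfl⟩
  rw [← hc]
  obtain ⟨k, hkdef⟩ : ∃ k : ℝ → ℝ, k = fun x => h x - c := ⟨_, rfl⟩
  have hk : LipschitzWith 1 k := by
    refine LipschitzWith.of_dist_le_mul fun x y => ?_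
    simpa [hkdef, Real.dist_eq] using hh.abs_sub_le x y
  have hkn : LipschitzWith 1 (fun x => k (-x)) := by
    refine LipschitzWith.of_dist_le_mul fun x y => ?_
    have := hk.abs_sub_le (-x) (-y)
    rw [show -x - -y = -(x - y) by ring, abs_neg] at this
    simpa [Real.dist_eq] using this
  have hk0 : |k 0| ≤ 1 := by
    have := hh.abs_integral_sub_le_one integrable_id_gaussianReal integrable_sq_gaussianReal
      integral_sq_gaussianReal.le
    rw [← hc, abs_sub_comm] at this
    simpa [hkdef] using this
  have hki := hk.integrable_mul_gaussian
  have hkc : Continuous fun t : ℝ => k t * Real.exp (-(1 / 2) * t ^ 2) := by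
    have := hk.continuous
    fun_prop
  have htot : ∫ t, k t * Real.exp (-(1 / 2) * t ^ 2) = 0 := by
    have h1 : ∫ t, k t ∂(gaussianReal 0 1) = 0 := by
      rw [hkdef, integral_sub (hh.integrable_of_integrable_id integrable_id_gaussianReal)
        (integrable_const _), ← hc]
      simp
    rw [integral_gaussianReal_zero_one] at h1
    rcases mul_eq_zero.1 h1 with h2 | h2
    · have : (0 : ℝ) < (√(2 * Real.pi))⁻¹ := by positivity
      linarith
    · exact h2
  have htail : ∀ x, ∫ t in Set.Ioi x, k t * Real.exp (-(1 / 2) * t ^ 2) =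
      (∫ t in Set.Ioi (0 : ℝ), k t * Real.exp (-(1 / 2) * t ^ 2)) -
        ∫ t in (0 : ℝ)..x, k t * Real.exp (-(1 / 2) * t ^ 2) := fun x => by
    have := intervalIntegral.integral_Ioi_sub_Ioi' (a := 0) (b := x) hki.integrableOn
      hki.integrableOn
    linarith
  -- Since `k` has Gaussian mean zero, the right tail is minus the left tail; this carries the
  -- bounds for `x ≥ 0` over to `x ≤ 0` by reflection.
  have hrefl : ∀ x, gaussianTail k x = -gaussianTail (fun x => k (-x)) (-x) := fun x => by
    have h1 := intervalIntegral.integral_Iic_add_Ioi (b := x) hki.integrableOn hki.integrableOn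
    rw [htot] at h1
    have h2 := integral_comp_neg_Ioi (-x) (fun t => k t * Real.exp (-(1 / 2) * t ^ 2))
    simp only [neg_sq, neg_neg] at h2
    unfold gaussianTail
    simp only [neg_sq]
    rw [h2, eq_neg_of_add_eq_zero_right h1]
    ring
  obtain ⟨f, hf⟩ : ∃ f : ℝ → ℝ, f = fun x => -gaussianTail k x := ⟨_, rfl⟩
  have hderiv : ∀ x, HasDerivAt f (x * f x + k x) x := fun x => by
    have h1 : HasDerivAt (fun x => ∫ t in (0 : ℝ)..x, k t * Real.exp (-(1 / 2) * t ^ 2))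
        (k x * Real.exp (-(1 / 2) * x ^ 2)) x :=
      intervalIntegral.integral_hasDerivAt_right (hkc.intervalIntegrable _ _)
        (hkc.stronglyMeasurableAtFilter _ _) hkc.continuousAt
    have h2 : HasDerivAt (fun x : ℝ => Real.exp (1 / 2 * x ^ 2))
        (x * Real.exp (1 / 2 * x ^ 2)) x := by
      have := (((hasDerivAt_id x).pow 2).const_mul (1 / 2 : ℝ)).exp
      convert! this using 1
      simp; ring
    have h3 := (h2.mul (h1.const_sub (∫ t in Set.Ioi (0 : ℝ),
      k t * Real.exp (-(1 / 2) * t ^ 2)))).neg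
    have e : f = -((fun x : ℝ => Real.exp (1 / 2 * x ^ 2)) *
        fun x => (∫ t in Set.Ioi (0 : ℝ), k t * Real.exp (-(1 / 2) * t ^ 2)) -
          ∫ t in (0 : ℝ)..x, k t * Real.exp (-(1 / 2) * t ^ 2)) := by
      ext y
      simp only [hf, gaussianTail, htail y, Pi.neg_apply, Pi.mul_apply]
    have hE := exp_mul_gaussian x
    rw [← e] at h3
    convert! h3 using 1
    simp only [hf, gaussianTail, htail x]
    linear_combination (-k x) * hE
  have hbound : ∀ x, |x * f x + k x| ≤ 15 ∧ |x * (x * f x + k x) + f x| ≤ 14 := fun x => by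
    rcases le_total 0 x with hx | hx
    · have hb := gaussianTail_bounds hk hk0 hx
      simp only [hf]
      convert hb using 3 <;> ring_nf
    · have hb := gaussianTail_bounds hkn (by simpa using hk0) (neg_nonneg.2 hx)
      simp only [hf, hrefl x]
      simp only [neg_neg] at hb ⊢
      refine ⟨?_, ?_⟩
      · convert hb.1 using 2; ring_nf
      · rw [← abs_neg]; convert hb.2 using 2; ring_nf
  refine ⟨f, fun x => x * f x + k x, hderiv, fun x => by simp [hkdef],
    fun x => (hbound x).1, fun x y => ?_⟩
  have hxf : ∀ x, HasDerivAt (fun x => x * f x) (x * (x * f x + k x) + f x) x := fun x => by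
    have := (hasDerivAt_id x).mul (hderiv x)
    convert! this using 1
    simp; ring
  -- As `f' = x f + k`, its Lipschitz constant is at most 14 from `x f` plus 1 from `k`.
  have h1 := Convex.norm_image_sub_le_of_norm_hasDerivWithin_le (s := Set.univ) (C := 14)
    (fun x _ => (hxf x).hasDerivWithinAt) (fun x _ => (hbound x).2) convex_univ
    (Set.mem_univ y) (Set.mem_univ x)
  have h2 := hk.abs_sub_le x y
  rw [Real.norm_eq_abs, Real.norm_eq_abs] at h1
  calc |x * f x + k x - (y * f y + k y)| = |(x * f x - y * f y) + (k x - k y)| := by ring_nf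
    _ ≤ |x * f x - y * f y| + |k x - k y| := abs_add_le _ _
    _ ≤ 15 * |x - y| := by linarith

/-- A first-order Taylor bound for a function with Lipschitz derivative. -/
lemma abs_taylor_le {f f' : ℝ → ℝ} {C : ℝ} (hf : ∀ x, HasDerivAt f (f' x) x)
    (hL : ∀ x y, |f' x - f' y| ≤ C * |x - y|) (x d : ℝ) :
    |f (x + d) - f x - f' x * d| ≤ C * d ^ 2 := by
  have hC : 0 ≤ C := by
    have := (abs_nonneg _).trans (hL 1 0)
    simpa using this
  have hd : ∀ u, HasDerivAt (fun u => f u - f' x * u) (f' u - f' x) u := fun u => by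
    convert! (hf u).sub ((hasDerivAt_id u).const_mul (f' x)) using 1
    simp
  have h := Convex.norm_image_sub_le_of_norm_hasDerivWithin_le (s := Set.uIcc x (x + d))
    (C := C * |d|) (fun u _ => (hd u).hasDerivWithinAt) (fun u hu => by
      rw [Real.norm_eq_abs]
      refine (hL u x).trans (mul_le_mul_of_nonneg_left ?_ hC)
      have := Set.abs_sub_left_of_mem_uIcc hu
      simpa using this) (convex_uIcc _ _) Set.left_mem_uIcc Set.right_mem_uIcc
  rw [Real.norm_eq_abs, Real.norm_eq_abs] at h
  calc |f (x + d) - f x - f' x * d| = |f (x + d) - f' x * (x + d) - (f x - f' x * x)| := by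
        ring_nf
    _ ≤ C * |d| * |x + d - x| := h
    _ = C * d ^ 2 := by rw [add_sub_cancel_left, mul_assoc, ← sq, sq_abs]

open scoped BigOperators

/-! ### Averages over a product of finite sets -/

lemma expect_fin_succ {β : Type*} [Fintype β] {n : ℕ} (F : (Fin (n + 1) → β) → ℝ) :
    𝔼 x, F x = 𝔼 a, 𝔼 y : Fin n → β, F (Fin.cons a y) := by
  have h := Finset.expect_product' (Finset.univ : Finset β)
    (Finset.univ : Finset (Fin n → β)) fun a y => F (Fin.cons a y)
  rw [Finset.univ_product_univ] at h
  rw [← h]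
  exact (Fintype.expect_equiv (Fin.consEquiv fun _ => β) _ _ fun _ => rfl).symm

/-- The Efron–Stein inequality for functions with bounded differences. -/
theorem expect_sq_le_of_bounded_differences {β : Type*} [Fintype β] [Nonempty β] {c : ℝ} {n : ℕ}
    (F : (Fin n → β) → ℝ) (hF : ∀ x i a, |F (Function.update x i a) - F x| ≤ c) :
    𝔼 x, F x ^ 2 ≤ (𝔼 x, F x) ^ 2 + n * c ^ 2 := by
  induction n with
  | zero => simp
  | succ n ih =>
    rw [expect_fin_succ, expect_fin_succ]
    have h1 : ∀ a, 𝔼 y : Fin n → β, F (Fin.cons a y) ^ 2 ≤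
        (𝔼 y : Fin n → β, F (Fin.cons a y)) ^ 2 + n * c ^ 2 := fun a =>
      ih (fun y => F (Fin.cons a y)) fun y i b => by
        simp only [Fin.cons_update]
        exact hF _ _ _
    -- `G` is the conditional mean given the first coordinate. The induction hypothesis controls the
    -- variance within each slice, and `G` itself varies by at most `c`.
    obtain ⟨G, hG⟩ : ∃ G : β → ℝ, G = fun a => 𝔼 y : Fin n → β, F (Fin.cons a y) := ⟨_, rfl⟩
    have hGd : ∀ a b, |G a - G b| ≤ c := fun a b => by
      rw [hG]
      simp only
      rw [← Finset.expect_sub_distrib]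
      refine (Finset.abs_expect_le _ _).trans
        (Finset.expect_le Finset.univ_nonempty fun y _ => ?_)
      have := hF (Fin.cons b y) 0 a
      rwa [Fin.update_cons_zero] at this
    have hGm : ∀ a, |G a - 𝔼 b, G b| ≤ c := fun a => by
      have e : G a - 𝔼 b, G b = 𝔼 b, (G a - G b) := by
        rw [Finset.expect_sub_distrib, Fintype.expect_const]
      rw [e]
      exact (Finset.abs_expect_le _ _).trans
        (Finset.expect_le Finset.univ_nonempty fun b _ => hGd a b)
    have h2 : 𝔼 a, (G a - 𝔼 b, G b) ^ 2 ≤ c ^ 2 :=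
      Finset.expect_le Finset.univ_nonempty fun a _ => sq_le_sq' (by
        have := (abs_le.1 (hGm a)).1; linarith) (abs_le.1 (hGm a)).2
    have h3 : 𝔼 a, (G a - 𝔼 b, G b) ^ 2 = 𝔼 a, G a ^ 2 - (𝔼 b, G b) ^ 2 := by
      have e : ∀ a, (G a - 𝔼 b, G b) ^ 2 =
          G a ^ 2 - 2 * (𝔼 b, G b) * G a + (𝔼 b, G b) ^ 2 := fun a => by ring
      simp_rw [e]
      rw [Finset.expect_add_distrib, Finset.expect_sub_distrib, ← Finset.mul_expect,
        Fintype.expect_const]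
      ring
    calc 𝔼 a, 𝔼 y : Fin n → β, F (Fin.cons a y) ^ 2
        ≤ 𝔼 a, (G a ^ 2 + n * c ^ 2) := by
          rw [hG]; exact Finset.expect_le_expect fun a _ => h1 a
      _ = 𝔼 a, G a ^ 2 + n * c ^ 2 := by
          rw [Finset.expect_add_distrib, Fintype.expect_const]
      _ ≤ (𝔼 a, G a) ^ 2 + (n + 1 : ℕ) * c ^ 2 := by push_cast; linarith
      _ = _ := by rw [hG]

/-- The average absolute deviation of a function with bounded differences. -/
lemma expect_abs_sub_le_of_bounded_differences {β : Type*} [Fintype β] [Nonempty β] {c : ℝ}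
    (hc : 0 ≤ c) {n : ℕ}
    (F : (Fin n → β) → ℝ) (hF : ∀ x i a, |F (Function.update x i a) - F x| ≤ c) :
    𝔼 x, |F x - 𝔼 y, F y| ≤ √n * c := by
  have h1 := expect_sq_le_of_bounded_differences (fun x => F x - 𝔼 y, F y) (c := c)
    fun x i a => by simpa using hF x i a
  have h2 := Finset.expect_mul_sq_le_sq_mul_sq (Finset.univ : Finset (Fin n → β))
    (fun x => |F x - 𝔼 y, F y|) (fun _ => 1)
  rw [Finset.expect_sub_distrib, Fintype.expect_const, sub_self] at h1
  simp only [mul_one, sq_abs, one_pow, Fintype.expect_const] at h2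
  refine abs_le_of_sq_le_sq' ?_ (by positivity) |>.2
  rw [mul_pow, Real.sq_sqrt (Nat.cast_nonneg n)]
  linarith

/-! ### Empty boxes -/

variable {n m : ℕ}

lemma emptyBoxes_eq_sum (x : Fin n → Fin m) :
    (emptyBoxes x : ℝ) = ∑ b, if ∀ i, x i ≠ b then (1 : ℝ) else 0 := by
  rw [emptyBoxes, Finset.natCast_card_filter]

lemma emptyBoxes_le (x : Fin n → Fin m) : (emptyBoxes x : ℝ) ≤ m := by
  have : emptyBoxes x ≤ m := by
    have h := Finset.card_filter_le (Finset.univ : Finset (Fin m)) fun b => ∀ i, x i ≠ b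
    rwa [Finset.card_univ, Fintype.card_fin] at h
  exact_mod_cast this

/-- A box empty under `x` but not under `y` contains, under `y`, a ball that the two configurations
place differently. -/
lemma emptyBoxes_le_add (x y : Fin n → Fin m) :
    emptyBoxes x ≤ emptyBoxes y + (Finset.univ.filter fun i => x i ≠ y i).card := by
  classical
  have hsub : (Finset.univ.filter fun b : Fin m => ∀ i, x i ≠ b) ⊆
      (Finset.univ.filter fun b : Fin m => ∀ i, y i ≠ b) ∪
        (Finset.univ.filter fun i => x i ≠ y i).image y := by
    intro b hb
    rw [Finset.mem_filter] at hb
    rw [Finset.mem_union, Finset.mem_filter, Finset.mem_image]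
    by_cases h : ∀ i, y i ≠ b
    · exact Or.inl ⟨Finset.mem_univ _, h⟩
    · push Not at h
      obtain ⟨i, hi⟩ := h
      refine Or.inr ⟨i, ?_, hi⟩
      rw [Finset.mem_filter]
      exact ⟨Finset.mem_univ _, fun e => hb.2 i (e.trans hi)⟩
  exact (Finset.card_le_card hsub).trans ((Finset.card_union_le _ _).trans
    (Nat.add_le_add_left Finset.card_image_le _))

lemma abs_emptyBoxes_sub_le (x y : Fin n → Fin m) :
    |(emptyBoxes x : ℝ) - emptyBoxes y| ≤ (Finset.univ.filter fun i => x i ≠ y i).card := by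
  have h1 := emptyBoxes_le_add x y
  have h2 := emptyBoxes_le_add y x
  simp_rw [ne_comm (a := y _)] at h2
  rify at h1 h2
  rw [abs_le]
  constructor <;> linarith

lemma abs_emptyBoxes_update_sub_le (x : Fin n → Fin m) (i : Fin n) (a : Fin m) :
    |(emptyBoxes (Function.update x i a) : ℝ) - emptyBoxes x| ≤ 1 := by
  refine (abs_emptyBoxes_sub_le _ _).trans ?_
  have : (Finset.univ.filter fun j => Function.update x i a j ≠ x j) ⊆ {i} := by
    intro j hj
    rw [Finset.mem_filter] at hj
    rw [Finset.mem_singleton]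
    by_contra h
    exact hj.2 (Function.update_of_ne h _ _)
  exact_mod_cast (Finset.card_le_card this).trans (Finset.card_singleton _).le

/-- The number of balls in box `b`. -/
def boxLoad (x : Fin n → Fin m) (b : Fin m) : ℕ :=
  (Finset.univ.filter fun i => x i = b).card

lemma boxLoad_eq_sum (x : Fin n → Fin m) (b : Fin m) :
    (boxLoad x b : ℝ) = ∑ i, if x i = b then (1 : ℝ) else 0 := by
  rw [boxLoad, Finset.natCast_card_filter]

lemma sum_boxLoad (x : Fin n → Fin m) : ∑ b, (boxLoad x b : ℝ) = n := by
  simp_rw [boxLoad_eq_sum]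
  rw [Finset.sum_comm]
  simp

lemma boxLoad_cons (a : Fin m) (y : Fin n → Fin m) (b : Fin m) :
    (boxLoad (Fin.cons a y : Fin (n + 1) → Fin m) b : ℝ) =
      (if a = b then 1 else 0) + boxLoad y b := by
  simp only [boxLoad_eq_sum, Fin.sum_univ_succ, Fin.cons_zero, Fin.cons_succ]

lemma boxLoad_moments [NeZero m] (b : Fin m) :
    𝔼 x : Fin n → Fin m, (boxLoad x b : ℝ) = n / m ∧
      𝔼 x : Fin n → Fin m, (boxLoad x b : ℝ) ^ 2 ≤ n / m + (n / m) ^ 2 := by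
  have hI : 𝔼 a : Fin m, (if a = b then (1 : ℝ) else 0) = 1 / m := by
    simp
  induction n with
  | zero => simp [boxLoad_eq_sum]
  | succ n ih =>
    obtain ⟨ih1, ih2⟩ := ih
    rw [expect_fin_succ, expect_fin_succ]
    simp_rw [boxLoad_cons]
    refine ⟨?_, ?_⟩
    · simp_rw [Finset.expect_add_distrib, Fintype.expect_const]
      rw [hI, ih1]
      push_cast; ring
    · have e : ∀ (a : Fin m) (y : Fin n → Fin m),
          ((if a = b then (1 : ℝ) else 0) + boxLoad y b) ^ 2 =
          (if a = b then (1 : ℝ) else 0) + 2 * (if a = b then (1 : ℝ) else 0) * boxLoad y b +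
            (boxLoad y b : ℝ) ^ 2 := fun a y => by
        split_ifs <;> ring
      simp_rw [e, Finset.expect_add_distrib, Fintype.expect_const, ← Finset.mul_expect,
        ← Finset.expect_mul, ← Finset.mul_expect]
      rw [hI, ih1]
      have hm : (0 : ℝ) ≤ 1 / m := by positivity
      push_cast
      -- The induction step leaves a surplus `(1/m)²`, which is dropped.
      have e2 : ((n : ℝ) + 1) / m + ((n + 1) / m) ^ 2 =
        1 / m + 2 * (1 / m) * (n / m) + (n / m + (n / m) ^ 2) + (1 / m) ^ 2 := by ring
      rw [e2]
      nlinarith [sq_nonneg (1 / (m : ℝ))]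

/-! ### The size-bias coupling: emptying a box -/

/-- Move each ball of `x` that lies in box `b` to the box that `y` prescribes. -/
def emptyOut (b : Fin m) (y : Fin n → {c : Fin m // c ≠ b}) (x : Fin n → Fin m) : Fin n → Fin m :=
  fun i => if x i = b then y i else x i

/-- Exchange a box with a box other than `b`, unless the former is `b`. -/
def swapUnless (b : Fin m) : Equiv.Perm (Fin m × {c : Fin m // c ≠ b}) where
  toFun p := if h : p.1 = b then p else (p.2, ⟨p.1, h⟩)
  invFun p := if h : p.1 = b then p else (p.2, ⟨p.1, h⟩)
  left_inv p := by
    obtain ⟨a, c, hc⟩ := p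
    by_cases h : a = b <;> simp [h, hc]
  right_inv p := by
    obtain ⟨a, c, hc⟩ := p
    by_cases h : a = b <;> simp [h, hc]

lemma swapUnless_snd (b : Fin m) (p : Fin m × {c : Fin m // c ≠ b}) :
    ((swapUnless b p).2 : Fin m) = if p.1 = b then (p.2 : Fin m) else p.1 := by
  by_cases h : p.1 = b <;> simp [swapUnless, h]

/-- For each ball, `swapUnless b` permutes the pairs (old box, prescribed box), and its second
component is the box after emptying. Applied ball by ball it preserves the uniform law, so the
emptied configuration is distributed as `y`. -/
lemma expect_emptyOut [NeZero m] (b : Fin m) (G : (Fin n → Fin m) → ℝ) :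
    𝔼 x, 𝔼 y, G (emptyOut b y x) =
      𝔼 y : Fin n → {c : Fin m // c ≠ b}, G fun i => (y i : Fin m) := by
  have e1 : 𝔼 x, 𝔼 y, G (emptyOut b y x) =
      𝔼 p : (Fin n → Fin m) × (Fin n → {c : Fin m // c ≠ b}), G (emptyOut b p.2 p.1) := by
    have h := Finset.expect_product' (Finset.univ : Finset (Fin n → Fin m))
      (Finset.univ : Finset (Fin n → {c : Fin m // c ≠ b})) fun x y => G (emptyOut b y x)
    rw [Finset.univ_product_univ] at h
    exact h.symm
  have e2 : 𝔼 p : (Fin n → Fin m) × (Fin n → {c : Fin m // c ≠ b}), G (fun i => (p.2 i : Fin m)) =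
      𝔼 y : Fin n → {c : Fin m // c ≠ b}, G fun i => (y i : Fin m) := by
    have h := Finset.expect_product' (Finset.univ : Finset (Fin n → Fin m))
      (Finset.univ : Finset (Fin n → {c : Fin m // c ≠ b})) fun x y => G fun i => (y i : Fin m)
    rw [Finset.univ_product_univ] at h
    rw [h, Fintype.expect_const]
  rw [e1, ← e2]
  refine Fintype.expect_equiv (((Equiv.arrowProdEquivProdArrow _ _ _).symm.trans
    (Equiv.piCongrRight fun _ => swapUnless b)).trans (Equiv.arrowProdEquivProdArrow _ _ _))
    _ _ fun p => ?_
  congr 1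
  funext i
  exact (swapUnless_snd b (p.1 i, p.2 i)).symm

lemma card_ne (b : Fin m) : Fintype.card {c : Fin m // c ≠ b} = m - 1 := by
  simp

lemma sum_avoiding_eq (hm : 2 ≤ m) (b : Fin m) (G : (Fin n → Fin m) → ℝ) :
    𝔼 x, (if ∀ i, x i ≠ b then (1 : ℝ) else 0) * G x =
      (((m : ℝ) - 1) / m) ^ n * 𝔼 y : Fin n → {c : Fin m // c ≠ b}, G fun i => (y i : Fin m) := by
  have hs : ∑ x, (if ∀ i, x i ≠ b then (1 : ℝ) else 0) * G x =
      ∑ y : Fin n → {c : Fin m // c ≠ b}, G fun i => (y i : Fin m) := by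
    simp_rw [ite_mul, one_mul, zero_mul]
    rw [← Finset.sum_filter]
    symm
    refine Finset.sum_bij (fun y _ i => (y i : Fin m)) ?_ ?_ ?_ ?_
    · intro y _
      rw [Finset.mem_filter]
      exact ⟨Finset.mem_univ _, fun i => (y i).2⟩
    · intro y _ z _ h
      funext i
      exact Subtype.ext (congrFun h i)
    · intro x hx
      rw [Finset.mem_filter] at hx
      exact ⟨fun i => ⟨x i, hx.2 i⟩, Finset.mem_univ _, rfl⟩
    · intro y _; rfl
  have hm1 : ((m - 1 : ℕ) : ℝ) = (m : ℝ) - 1 := by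
    rw [Nat.cast_sub (by omega)]; simp
  have hm2 : (2 : ℝ) ≤ m := by exact_mod_cast hm
  rw [Fintype.expect_eq_sum_div_card, Fintype.expect_eq_sum_div_card, hs, Fintype.card_fun,
    Fintype.card_fun, card_ne, Fintype.card_fin, Fintype.card_fin]
  push_cast
  rw [hm1, div_pow]
  have h1 : ((m : ℝ) - 1) ^ n ≠ 0 := pow_ne_zero _ (by linarith)
  have h2 : (m : ℝ) ^ n ≠ 0 := pow_ne_zero _ (by linarith)
  field_simp

/-- The size-bias identity for the number of empty boxes. -/
theorem expect_emptyBoxes_mul (hm : 2 ≤ m) (G : (Fin n → Fin m) → ℝ) :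
    𝔼 x, (emptyBoxes x : ℝ) * G x =
      (((m : ℝ) - 1) / m) ^ n * ∑ b : Fin m, 𝔼 x, 𝔼 y, G (emptyOut b y x) := by
  have : NeZero m := ⟨by omega⟩
  simp_rw [emptyBoxes_eq_sum, Finset.sum_mul]
  rw [Finset.expect_sum_comm, Finset.mul_sum]
  refine Finset.sum_congr rfl fun b _ => ?_
  rw [sum_avoiding_eq hm, expect_emptyOut]

lemma nonempty_ne (hm : 2 ≤ m) (b : Fin m) : Nonempty {c : Fin m // c ≠ b} := by
  have : Nontrivial (Fin m) := Fin.nontrivial_iff_two_le.2 hm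
  obtain ⟨c, hc⟩ := exists_ne b
  exact ⟨⟨c, hc⟩⟩

/-- The coordinates of `y` are independent, and each avoids `c` with probability `(m - 2)/(m - 1)`.
-/
lemma expect_avoid (hm : 2 ≤ m) {b c : Fin m} (hc : c ≠ b) (A : Finset (Fin n)) :
    𝔼 y : Fin n → {c : Fin m // c ≠ b}, (if ∀ i ∈ A, (y i : Fin m) ≠ c then (1 : ℝ) else 0) =
      (((m : ℝ) - 2) / (m - 1)) ^ A.card := by
  classical
  have hm1 : ((m - 1 : ℕ) : ℝ) = (m : ℝ) - 1 := by
    rw [Nat.cast_sub (by omega)]; simp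
  have hm2 : (2 : ℝ) ≤ m := by exact_mod_cast hm
  have h1 : ((m : ℝ) - 1) ≠ 0 := by linarith
  have e : ∀ y : Fin n → {c : Fin m // c ≠ b},
      (if ∀ i ∈ A, (y i : Fin m) ≠ c then (1 : ℝ) else 0) =
      ∏ i, if i ∈ A → (y i : Fin m) ≠ c then (1 : ℝ) else 0 := fun y => by
    rw [Finset.prod_ite_zero]
    simp
  have hsum : ∀ i : Fin n, (∑ d : {c : Fin m // c ≠ b},
      if i ∈ A → (d : Fin m) ≠ c then (1 : ℝ) else 0) =
        if i ∈ A then (m : ℝ) - 2 else (m : ℝ) - 1 := fun i => by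
    by_cases hi : i ∈ A
    · simp only [hi, true_imp_iff, if_true]
      have e2 : ∀ d : {c : Fin m // c ≠ b}, (if (d : Fin m) ≠ c then (1 : ℝ) else 0) =
          1 - if d = ⟨c, hc⟩ then 1 else 0 := fun d => by
        by_cases h : (d : Fin m) = c
        · have : d = ⟨c, hc⟩ := Subtype.ext h
          simp [this]
        · have : d ≠ ⟨c, hc⟩ := fun h' => h (congrArg Subtype.val h')
          simp [h, this]
      simp_rw [e2]
      rw [Finset.sum_sub_distrib, Finset.sum_ite_eq']
      simp only [Finset.sum_const, Finset.card_univ, card_ne, nsmul_eq_mul, hm1,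
        Finset.mem_univ, if_true]
      ring
    · simp only [hi, false_imp_iff, if_true, if_false]
      simp only [Finset.sum_const, Finset.card_univ, card_ne, nsmul_eq_mul, hm1]
      ring
  rw [Fintype.expect_eq_sum_div_card, Fintype.card_fun, card_ne, Fintype.card_fin]
  simp_rw [e]
  rw [← Fintype.prod_sum (fun (i : Fin n) (d : {c : Fin m // c ≠ b}) =>
    if i ∈ A → (d : Fin m) ≠ c then (1 : ℝ) else 0)]
  simp_rw [hsum]
  push_cast
  have hpow : ((m : ℝ) - 1) ^ n = ∏ _i : Fin n, ((m : ℝ) - 1) := by simp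
  rw [hm1, hpow, ← Finset.prod_div_distrib]
  have e3 : ∀ i : Fin n, (if i ∈ A then (m : ℝ) - 2 else (m : ℝ) - 1) / (m - 1) =
      if i ∈ A then ((m : ℝ) - 2) / (m - 1) else 1 := fun i => by
    split_ifs
    · rfl
    · exact div_self h1
  rw [Finset.prod_congr rfl fun i _ => e3 i]
  simp [Finset.prod_ite_mem, div_pow]

/-! ### The drift of the number of empty boxes and its bounded differences. -/

lemma emptyBoxes_emptyOut (b : Fin m) (y : Fin n → {c : Fin m // c ≠ b}) (x : Fin n → Fin m) :
    (emptyBoxes (emptyOut b y x) : ℝ) = 1 + ∑ c ∈ Finset.univ.erase b,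
      (if ∀ i, x i ≠ c then (1 : ℝ) else 0) *
        if ∀ i ∈ Finset.univ.filter (fun i => x i = b), (y i : Fin m) ≠ c then 1 else 0 := by
  rw [emptyBoxes_eq_sum, ← Finset.add_sum_erase _ _ (Finset.mem_univ b)]
  congr 1
  · rw [if_pos]
    intro i
    unfold emptyOut
    split_ifs with h
    · exact (y i).2
    · exact h
  · refine Finset.sum_congr rfl fun c hc => ?_
    rw [Finset.mem_erase] at hc
    rw [ite_zero_mul_ite_zero, mul_one]
    refine if_congr ⟨?_, ?_⟩ rfl rfl
    · intro h
      refine ⟨fun i hi => ?_, fun i hi => ?_⟩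
      · have := h i
        unfold emptyOut at this
        rw [if_neg (fun e => hc.1 (hi.symm.trans e))] at this
        exact this hi
      · have := h i
        unfold emptyOut at this
        rwa [if_pos (Finset.mem_filter.1 hi).2] at this
    · rintro ⟨h1, h2⟩ i
      unfold emptyOut
      split_ifs with h
      · exact h2 i (Finset.mem_filter.2 ⟨Finset.mem_univ _, h⟩)
      · exact h1 i

lemma expect_emptyBoxes_emptyOut (hm : 2 ≤ m) (b : Fin m) (x : Fin n → Fin m) :
    𝔼 y, (emptyBoxes (emptyOut b y x) : ℝ) = 1 +
      ((emptyBoxes x : ℝ) - if ∀ i, x i ≠ b then 1 else 0) *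
        (((m : ℝ) - 2) / (m - 1)) ^ boxLoad x b := by
  have := nonempty_ne hm b
  simp_rw [emptyBoxes_emptyOut]
  rw [Finset.expect_add_distrib, Fintype.expect_const, Finset.expect_sum_comm]
  congr 1
  rw [emptyBoxes_eq_sum, ← Finset.add_sum_erase _ _ (Finset.mem_univ b), add_sub_cancel_left,
    Finset.sum_mul]
  refine Finset.sum_congr rfl fun c hc => ?_
  rw [← Finset.mul_expect, expect_avoid hm (Finset.mem_erase.1 hc).1, boxLoad]

lemma boxLoad_eq_zero {x : Fin n → Fin m} {b : Fin m} (h : ∀ i, x i ≠ b) : boxLoad x b = 0 := by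
  rw [boxLoad, Finset.card_eq_zero, Finset.filter_eq_empty_iff]
  exact fun i _ => h i

/-- The total drift of the number of empty boxes under emptying out each box. -/
theorem sum_expect_emptyBoxes_emptyOut_sub (hm : 2 ≤ m) (x : Fin n → Fin m) :
    ∑ b, 𝔼 y, ((emptyBoxes (emptyOut b y x) : ℝ) - emptyBoxes x) =
      m - emptyBoxes x -
        emptyBoxes x * ∑ b, (1 - (((m : ℝ) - 2) / (m - 1)) ^ boxLoad x b) := by
  have h : ∀ b, 𝔼 y, ((emptyBoxes (emptyOut b y x) : ℝ) - emptyBoxes x) =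
      1 - (if ∀ i, x i ≠ b then (1 : ℝ) else 0) -
        emptyBoxes x * (1 - (((m : ℝ) - 2) / (m - 1)) ^ boxLoad x b) := fun b => by
    have := nonempty_ne hm b
    rw [Finset.expect_sub_distrib, Fintype.expect_const, expect_emptyBoxes_emptyOut hm]
    -- If `b` is already empty its load is 0 and no ball moves, so one formula covers both cases.
    split_ifs with hb
    · rw [boxLoad_eq_zero hb]; ring
    · ring
  simp_rw [h]
  rw [Finset.sum_sub_distrib, Finset.sum_sub_distrib, ← emptyBoxes_eq_sum, ← Finset.mul_sum]
  simp

lemma abs_emptyBoxes_emptyOut_sub_le (b : Fin m) (y : Fin n → {c : Fin m // c ≠ b})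
    (x : Fin n → Fin m) :
    |(emptyBoxes (emptyOut b y x) : ℝ) - emptyBoxes x| ≤ boxLoad x b := by
  refine (abs_emptyBoxes_sub_le _ _).trans ?_
  rw [boxLoad]
  refine Nat.cast_le.2 (Finset.card_le_card fun i hi => ?_)
  rw [Finset.mem_filter] at hi ⊢
  refine ⟨hi.1, ?_⟩
  by_contra h
  exact hi.2 (if_neg h)

/-- Factor out the smaller power and apply Bernoulli to `1 - q ^ d`. -/
lemma abs_pow_sub_pow_le_one_sub_mul {q : ℝ} (h0 : 0 ≤ q) (h1 : q ≤ 1) (j k : ℕ) :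
    |q ^ j - q ^ k| ≤ (1 - q) * |(j : ℝ) - k| := by
  wlog h : j ≤ k generalizing j k
  · rw [abs_sub_comm, abs_sub_comm (j : ℝ)]
    exact this k j (by omega)
  obtain ⟨d, rfl⟩ := Nat.exists_eq_add_of_le h
  have hb := one_add_mul_le_pow (a := q - 1) (by linarith) d
  rw [add_sub_cancel] at hb
  have hq := pow_le_one₀ h0 h1 (n := j)
  have hq0 := pow_nonneg h0 j
  have hd := pow_le_one₀ h0 h1 (n := d)
  rw [pow_add, show q ^ j - q ^ j * q ^ d = q ^ j * (1 - q ^ d) by ring,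
    abs_of_nonneg (mul_nonneg hq0 (by linarith))]
  push_cast
  rw [sub_add_cancel_left, abs_neg, abs_of_nonneg (Nat.cast_nonneg d)]
  nlinarith

lemma sum_abs_boxLoad_update_sub_le (x : Fin n → Fin m) (i : Fin n) (a : Fin m) :
    ∑ b, |(boxLoad (Function.update x i a) b : ℝ) - boxLoad x b| ≤ 2 := by
  have h : ∀ b, |(boxLoad (Function.update x i a) b : ℝ) - boxLoad x b| ≤
      (if a = b then 1 else 0) + if x i = b then 1 else 0 := fun b => by
    rw [boxLoad_eq_sum, boxLoad_eq_sum, ← Finset.sum_sub_distrib,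
      Finset.sum_eq_single i (fun j _ hj => by rw [Function.update_of_ne hj, sub_self])
        (fun h => absurd (Finset.mem_univ i) h), Function.update_self]
    split_ifs <;> simp
  calc _ ≤ ∑ b, ((if a = b then (1 : ℝ) else 0) + if x i = b then 1 else 0) :=
        Finset.sum_le_sum fun b _ => h b
    _ = 2 := by rw [Finset.sum_add_distrib]; simp; norm_num

/-- The drift has bounded differences. -/
theorem abs_drift_update_sub_le (hm : 2 ≤ m) (D : (Fin n → Fin m) → ℝ)
    (hD : ∀ x, D x = m - emptyBoxes x -
        emptyBoxes x * ∑ b, (1 - (((m : ℝ) - 2) / (m - 1)) ^ boxLoad x b))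
    (x : Fin n → Fin m) (i : Fin n) (a : Fin m) :
    |D (Function.update x i a) - D x| ≤ 5 + 2 * (n / m) := by
  have hm2 : (2 : ℝ) ≤ m := by exact_mod_cast hm
  obtain ⟨q, hq⟩ : ∃ q : ℝ, q = ((m : ℝ) - 2) / (m - 1) := ⟨_, rfl⟩
  obtain ⟨p, hp⟩ : ∃ p : ℝ, p = 1 / ((m : ℝ) - 1) := ⟨_, rfl⟩
  have hqp : 1 - q = p := by
    have : (m : ℝ) - 1 ≠ 0 := by linarith
    rw [hq, hp]; field_simp; ring
  have hq0 : 0 ≤ q := by rw [hq]; exact div_nonneg (by linarith) (by linarith)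
  have hp0 : 0 ≤ p := by rw [hp]; exact div_nonneg (by linarith) (by linarith)
  have hpm : m * p ≤ 2 := by
    rw [hp, mul_one_div, div_le_iff₀ (by linarith)]; linarith
  obtain ⟨H, hH⟩ : ∃ H : (Fin n → Fin m) → ℝ, H = fun x => ∑ b, (1 - q ^ boxLoad x b) :=
    ⟨_, rfl⟩
  -- Moving one ball changes the loads by at most 2 in total, and each `q ^ load` is Lipschitz in
  -- the load with constant `p = 1 - q`.
  have hHd : |H (Function.update x i a) - H x| ≤ 2 * p := by
    rw [hH]
    simp only
    rw [← Finset.sum_sub_distrib]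
    calc _ ≤ ∑ b, |1 - q ^ boxLoad (Function.update x i a) b - (1 - q ^ boxLoad x b)| :=
          Finset.abs_sum_le_sum_abs _ _
      _ ≤ ∑ b, p * |(boxLoad (Function.update x i a) b : ℝ) - boxLoad x b| := by
          refine Finset.sum_le_sum fun b _ => ?_
          have h := abs_pow_sub_pow_le_one_sub_mul hq0 (by linarith)
            (boxLoad (Function.update x i a) b) (boxLoad x b)
          rw [hqp] at h
          rwa [sub_sub_sub_cancel_left, abs_sub_comm]
      _ ≤ 2 * p := by
          rw [← Finset.mul_sum]
          nlinarith [sum_abs_boxLoad_update_sub_le x i a]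
  have hHb : |H x| ≤ 2 * (n / m) := by
    rw [hH]
    calc _ ≤ ∑ b, |1 - q ^ boxLoad x b| := Finset.abs_sum_le_sum_abs _ _
      _ ≤ ∑ b, p * (boxLoad x b : ℝ) := by
          refine Finset.sum_le_sum fun b _ => ?_
          have h := abs_pow_sub_pow_le_one_sub_mul hq0 (by linarith) 0 (boxLoad x b)
          rw [hqp] at h
          simpa using h
      _ = n * p := by rw [← Finset.mul_sum, sum_boxLoad, mul_comm]
      _ ≤ 2 * (n / m) := by
          have hm0 : (0 : ℝ) < m := by linarith
          rw [← mul_div_assoc, le_div_iff₀ hm0]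
          have : (0 : ℝ) ≤ n := Nat.cast_nonneg n
          nlinarith
  have hW := abs_emptyBoxes_update_sub_le x i a
  have hWm : |(emptyBoxes (Function.update x i a) : ℝ)| ≤ m := by
    rw [abs_of_nonneg (Nat.cast_nonneg _)]; exact emptyBoxes_le _
  have e : ∀ z, D z = m - emptyBoxes z - emptyBoxes z * H z := fun z => by
    rw [hD, hH, hq]
  rw [e, e]
  set w' : ℝ := (emptyBoxes (Function.update x i a) : ℝ)
  set w : ℝ := (emptyBoxes x : ℝ)
  set h' := H (Function.update x i a)
  calc |(m : ℝ) - w' - w' * h' - (m - w - w * H x)|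
      = |-(w' - w) - w' * (h' - H x) - (w' - w) * H x| := by ring_nf
    _ ≤ |w' - w| + |w'| * |h' - H x| + |w' - w| * |H x| := by
        refine (abs_sub _ _).trans ?_
        rw [abs_mul]
        refine add_le_add_left ((abs_sub _ _).trans ?_) _
        rw [abs_neg, abs_mul]
    _ ≤ 1 + m * (2 * p) + 1 * (2 * (n / m)) := by gcongr
    _ ≤ _ := by linarith

/-! ### Mean and variance of the number of empty boxes -/

lemma expect_emptyBoxes (hm : 2 ≤ m) :
    𝔼 x : Fin n → Fin m, (emptyBoxes x : ℝ) = m * (((m : ℝ) - 1) / m) ^ n := by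
  have : NeZero m := ⟨by omega⟩
  have h := expect_emptyBoxes_mul (n := n) hm fun _ => 1
  have h1 : ∀ b : Fin m, 𝔼 _x : Fin n → Fin m, 𝔼 _y : Fin n → {c : Fin m // c ≠ b},
      (1 : ℝ) = 1 := fun b => by
    have := nonempty_ne hm b
    rw [Fintype.expect_const, Fintype.expect_const]
  simp_rw [mul_one, h1] at h
  rw [h]
  simp; ring

lemma expect_emptyBoxes_sq (hn : 1 ≤ n) (hm : 2 ≤ m) :
    𝔼 x : Fin n → Fin m, (emptyBoxes x : ℝ) ^ 2 =
      m * (((m : ℝ) - 1) / m) ^ n * (1 + (m - 1) * (((m : ℝ) - 2) / (m - 1)) ^ n) := by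
  have : NeZero m := ⟨by omega⟩
  have h := expect_emptyBoxes_mul (n := n) hm fun x => (emptyBoxes x : ℝ)
  have h1 : ∀ b : Fin m, 𝔼 x : Fin n → Fin m, 𝔼 y, (emptyBoxes (emptyOut b y x) : ℝ) =
      1 + (m - 1) * (((m : ℝ) - 2) / (m - 1)) ^ n := fun b => by
    rw [expect_emptyOut b fun x => (emptyBoxes x : ℝ)]
    -- Start from all balls in box `b`: emptying it yields exactly `y`, so the conditional formula
    -- gives the mean over configurations avoiding `b`. At least one ball is needed for `b` to be
    -- occupied.
    have h2 := expect_emptyBoxes_emptyOut hm b fun _ : Fin n => b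
    have h3 : (emptyBoxes fun _ : Fin n => b) = m - 1 := by
      have : ∀ c, (∀ _ : Fin n, b ≠ c) ↔ c ∈ ({b} : Finset (Fin m))ᶜ := fun c => by
        rw [Finset.mem_compl, Finset.mem_singleton]
        exact ⟨fun h e => h ⟨0, hn⟩ e.symm, fun h _ e => h e.symm⟩
      rw [emptyBoxes]
      simp_rw [this]
      rw [Finset.filter_mem_eq_inter, Finset.univ_inter, Finset.card_compl]
      simp
    have h4 : ¬ ∀ _ : Fin n, b ≠ b := fun h => h ⟨0, hn⟩ rfl
    have h5 : boxLoad (fun _ : Fin n => b) b = n := by simp [boxLoad]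
    rw [h3, if_neg h4, h5, sub_zero, Nat.cast_sub (by omega), Nat.cast_one] at h2
    have h6 : ∀ y, emptyOut b y (fun _ : Fin n => b) = fun i => (y i : Fin m) :=
      fun y => funext fun i => if_pos rfl
    simp_rw [← h2, h6]
  simp_rw [h1, ← sq] at h
  rw [h]
  simp; ring

lemma pow_one_sub_inv_le (n : ℕ) (hm : 2 ≤ m) :
    (((m : ℝ) - 1) / m) ^ n ≤ Real.exp (-(n / m)) := by
  have hm2 : (2 : ℝ) ≤ m := by exact_mod_cast hm
  have h : ((m : ℝ) - 1) / m ≤ Real.exp (-(1 / m)) := by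
    have := Real.add_one_le_exp (-(1 / (m : ℝ)))
    have e : ((m : ℝ) - 1) / m = -(1 / m) + 1 := by field_simp; ring
    rwa [e]
  calc _ ≤ Real.exp (-(1 / m)) ^ n :=
        pow_le_pow_left₀ (div_nonneg (by linarith) (by linarith)) h n
    _ = _ := by rw [← Real.exp_nat_mul]; congr 1; ring

lemma exp_mul_le_pow_one_sub_inv (n : ℕ) (hm : 2 ≤ m) :
    Real.exp (-(n / m)) * (1 - n / (m : ℝ) ^ 2) ≤ (((m : ℝ) - 1) / m) ^ n := by
  have hm2 : (2 : ℝ) ≤ m := by exact_mod_cast hm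
  have hm0 : (0 : ℝ) < 1 / m := by positivity
  have hm1 : 1 / (m : ℝ) ≤ 1 / 2 := one_div_le_one_div_of_le (by norm_num) hm2
  -- With `u = 1/m`, this is `e^(-u) (1 + u) ≤ 1` multiplied by `1 - u`; Bernoulli then handles the
  -- `n`-th power.
  have h : Real.exp (-(1 / m)) * (1 - (1 / (m : ℝ)) ^ 2) ≤ ((m : ℝ) - 1) / m := by
    have e : ((m : ℝ) - 1) / m = 1 - 1 / m := by field_simp
    have h1 := Real.add_one_le_exp (1 / (m : ℝ))
    have h2 : Real.exp (-(1 / (m : ℝ))) * (1 + 1 / m) ≤ 1 := by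
      rw [Real.exp_neg, inv_mul_le_iff₀ (Real.exp_pos _)]; linarith
    rw [e]
    nlinarith
  have hb := one_add_mul_le_pow (a := -(1 / (m : ℝ)) ^ 2) (by nlinarith) n
  calc Real.exp (-(n / m)) * (1 - n / (m : ℝ) ^ 2)
      ≤ Real.exp (-(n / m)) * (1 - (1 / (m : ℝ)) ^ 2) ^ n := by
        refine mul_le_mul_of_nonneg_left ?_ (Real.exp_pos _).le
        calc 1 - n / (m : ℝ) ^ 2 = 1 + n * -(1 / (m : ℝ)) ^ 2 := by ring
          _ ≤ _ := hb
    _ = (Real.exp (-(1 / m)) * (1 - (1 / (m : ℝ)) ^ 2)) ^ n := by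
        rw [mul_pow, ← Real.exp_nat_mul]; congr 2; ring
    _ ≤ _ := pow_le_pow_left₀ (mul_nonneg (Real.exp_pos _).le (by nlinarith)) h n

lemma mul_exp_neg_le_one (t : ℝ) : t * Real.exp (-t) ≤ 1 := by
  rw [Real.exp_neg, ← div_eq_mul_inv, div_le_one (Real.exp_pos _)]
  linarith [Real.add_one_le_exp t]

/-- The variance is at least its asymptotic value up to an additive constant. -/
theorem variance_emptyBoxes_lower (hn : 1 ≤ n) (hm : 2 ≤ m) :
    m * Real.exp (-(n / m)) - (m + n) * Real.exp (-(2 * (n / m))) - 2 ≤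
      𝔼 x : Fin n → Fin m, (emptyBoxes x : ℝ) ^ 2 -
        (𝔼 x : Fin n → Fin m, (emptyBoxes x : ℝ)) ^ 2 := by
  rw [expect_emptyBoxes hm, expect_emptyBoxes_sq hn hm]
  have hm2 : (2 : ℝ) ≤ m := by exact_mod_cast hm
  have hn0 : (0 : ℝ) ≤ n := Nat.cast_nonneg n
  have hu := pow_one_sub_inv_le n hm
  have hl := exp_mul_le_pow_one_sub_inv n hm
  obtain ⟨t, ht⟩ : ∃ t : ℝ, t = n / m := ⟨_, rfl⟩
  obtain ⟨r, hr⟩ : ∃ r : ℝ, r = ((m : ℝ) - 1) / m := ⟨_, rfl⟩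
  obtain ⟨ρ, hρ⟩ : ∃ ρ : ℝ, ρ = r ^ n := ⟨_, rfl⟩
  obtain ⟨E, hE⟩ : ∃ E : ℝ, E = Real.exp (-t) := ⟨_, rfl⟩
  have hE2 : Real.exp (-(2 * t)) = E ^ 2 := by
    rw [hE, ← Real.exp_nat_mul]; congr 1; push_cast; ring
  have ht0 : 0 ≤ t := by rw [ht]; positivity
  have hr0 : 0 ≤ r := by rw [hr]; exact div_nonneg (by linarith) (by linarith)
  have hρ0 : 0 ≤ ρ := by rw [hρ]; positivity
  have hE0 : 0 < E := by rw [hE]; exact Real.exp_pos _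
  have hE1 : E ≤ 1 := by rw [hE]; exact Real.exp_le_one_iff.2 (by linarith)
  have htE : t * E ≤ 1 := by rw [hE]; exact mul_exp_neg_le_one t
  have htE2 : 2 * t * E ^ 2 ≤ 1 := by
    rw [← hE2]; exact mul_exp_neg_le_one (2 * t)
  rw [← hr, ← ht, ← hρ, ← hE] at hu hl
  rw [← ht, hE2, ← hE, ← hr, ← hρ]
  -- `(m - 2)/(m - 1)` equals `r` times `1 - 1/(m - 1)²`, so Bernoulli compares its `n`-th power
  -- with `ρ`.
  have hq : r ^ n * (1 - n / ((m : ℝ) - 1) ^ 2) ≤ (((m : ℝ) - 2) / (m - 1)) ^ n := by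
    have h1 : (0 : ℝ) < (m - 1) ^ 2 := by nlinarith
    have h2 : 1 / ((m : ℝ) - 1) ^ 2 ≤ 1 := by rw [div_le_one h1]; nlinarith
    have hb := one_add_mul_le_pow (a := -(1 / ((m : ℝ) - 1) ^ 2)) (by linarith) n
    have e : ((m : ℝ) - 2) / (m - 1) = r * (1 + -(1 / ((m : ℝ) - 1) ^ 2)) := by
      have : (m : ℝ) - 1 ≠ 0 := by linarith
      rw [hr]; field_simp; ring
    rw [e, mul_pow]
    refine mul_le_mul_of_nonneg_left ?_ (by positivity)
    calc 1 - n / ((m : ℝ) - 1) ^ 2 = 1 + n * -(1 / ((m : ℝ) - 1) ^ 2) := by ring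
      _ ≤ _ := hb
  rw [← hρ] at hq
  have hm1 : (0 : ℝ) < m - 1 := by linarith
  have hq' : ρ * ((m - 1) - n / ((m : ℝ) - 1)) ≤ (m - 1) * (((m : ℝ) - 2) / (m - 1)) ^ n := by
    have := mul_le_mul_of_nonneg_left hq hm1.le
    calc _ = ((m : ℝ) - 1) * (ρ * (1 - n / ((m : ℝ) - 1) ^ 2)) := by field_simp
      _ ≤ _ := this
  have h1 : m * ρ * (1 + ρ * ((m - 1) - n / ((m : ℝ) - 1))) - (m * ρ) ^ 2 ≤
      m * ρ * (1 + (m - 1) * (((m : ℝ) - 2) / (m - 1)) ^ n) - (m * ρ) ^ 2 := by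
    gcongr
  have h2 : m * ρ * (1 + ρ * ((m - 1) - n / ((m : ℝ) - 1))) - (m * ρ) ^ 2 =
      m * ρ - ρ ^ 2 * (m + n + n / ((m : ℝ) - 1)) := by
    field_simp; ring
  have h3 : n / ((m : ℝ) - 1) ≤ 2 * t := by
    have hm0 : (0 : ℝ) < m := by linarith
    rw [ht, div_le_iff₀ hm1, mul_comm (2 : ℝ), mul_assoc, div_mul_eq_mul_div, le_div_iff₀ hm0]
    nlinarith
  have h4 : m * E - t * E ≤ m * ρ := by
    have := mul_le_mul_of_nonneg_left hl (by linarith : (0 : ℝ) ≤ m)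
    calc m * E - t * E = m * (E * (1 - n / (m : ℝ) ^ 2)) := by rw [ht]; field_simp
      _ ≤ _ := this
  have h5 : ρ ^ 2 * (m + n + n / ((m : ℝ) - 1)) ≤ E ^ 2 * (m + n + 2 * t) := by
    gcongr
  -- The errors are `t E` and `2 t E²`, each at most 1 by `s e^(-s) ≤ 1`; together they make the
  -- constant 2.
  nlinarith

lemma variance_emptyBoxes_upper (hm : 2 ≤ m) :
    𝔼 x : Fin n → Fin m, (emptyBoxes x : ℝ) ^ 2 -
        (𝔼 x : Fin n → Fin m, (emptyBoxes x : ℝ)) ^ 2 ≤ n := by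
  have : NeZero m := ⟨by omega⟩
  have := expect_sq_le_of_bounded_differences (fun x : Fin n → Fin m => (emptyBoxes x : ℝ))
    (c := 1) abs_emptyBoxes_update_sub_le
  linarith

/-! ### Stein's method with the size-bias coupling -/

/-- The first error measures how far `D` is from its mean, the second is the Taylor remainder of `f`
along the coupling. -/
theorem stein_sizeBias_bound (hm : 2 ≤ m) {μ σ : ℝ} (hσ : 0 < σ)
    (hμ : μ = 𝔼 x : Fin n → Fin m, (emptyBoxes x : ℝ))
    (hv : σ ^ 2 = 𝔼 x : Fin n → Fin m, (emptyBoxes x : ℝ) ^ 2 - μ ^ 2)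
    (D : (Fin n → Fin m) → ℝ)
    (hD : ∀ x, D x = ∑ b, 𝔼 y, ((emptyBoxes (emptyOut b y x) : ℝ) - emptyBoxes x))
    {h : ℝ → ℝ} (hh : LipschitzWith 1 h) :
    |𝔼 x : Fin n → Fin m, h ((emptyBoxes x - μ) / σ) - ∫ t, h t ∂(gaussianReal 0 1)| ≤
      15 * (((m : ℝ) - 1) / m) ^ n * (𝔼 x, |D x - 𝔼 z, D z|) / σ ^ 2 +
      15 * (((m : ℝ) - 1) / m) ^ n * (𝔼 x : Fin n → Fin m, ∑ b, (boxLoad x b : ℝ) ^ 2) / σ ^ 3 := by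
  have : NeZero m := ⟨by omega⟩
  have hne := nonempty_ne hm
  have hm2 : (2 : ℝ) ≤ m := by exact_mod_cast hm
  obtain ⟨f, f', hf, hst, hb, hL⟩ := exists_stein_solution hh
  obtain ⟨ρ, hρ⟩ : ∃ ρ : ℝ, ρ = (((m : ℝ) - 1) / m) ^ n := ⟨_, rfl⟩
  have hρ0 : 0 ≤ ρ := by
    rw [hρ]; exact pow_nonneg (div_nonneg (by linarith) (by linarith)) n
  have hμρ : μ = m * ρ := by rw [hμ, hρ, expect_emptyBoxes hm]
  have hsb := expect_emptyBoxes_mul (n := n) hm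
  rw [← hρ] at hsb ⊢
  obtain ⟨Z, hZ⟩ : ∃ Z : (Fin n → Fin m) → ℝ, Z = fun x => (emptyBoxes x - μ) / σ := ⟨_, rfl⟩
  have hcov : ∀ G : (Fin n → Fin m) → ℝ, 𝔼 x, (emptyBoxes x - μ) * G x =
      ρ * 𝔼 x, ∑ b, 𝔼 y, (G (emptyOut b y x) - G x) := fun G => by
    simp_rw [sub_mul, Finset.expect_sub_distrib, ← Finset.mul_expect, Fintype.expect_const,
      Finset.sum_sub_distrib]
    rw [Finset.expect_sub_distrib, Finset.expect_sum_comm, hsb, hμρ]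
    simp only [Finset.sum_const, Finset.card_univ, Fintype.card_fin, nsmul_eq_mul]
    rw [← Finset.mul_expect]
    ring
  -- The covariance identity for `W` itself: it normalises the main term, so that only the
  -- fluctuation of `D` survives.
  have hED : σ ^ 2 = ρ * 𝔼 x, D x := by
    have h1 := hcov fun x => (emptyBoxes x : ℝ)
    simp_rw [← hD] at h1
    rw [← h1, hv]
    simp_rw [sub_mul, Finset.expect_sub_distrib, ← Finset.mul_expect, ← hμ, sq]
  obtain ⟨R, hR⟩ : ∃ R : (b : Fin m) → (Fin n → {c : Fin m // c ≠ b}) → (Fin n → Fin m) → ℝ,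
      R = fun b y x => f (Z (emptyOut b y x)) - f (Z x) -
        f' (Z x) * (((emptyBoxes (emptyOut b y x) : ℝ) - emptyBoxes x) / σ) := ⟨_, rfl⟩
  have hRb : ∀ b y x, |R b y x| ≤ 15 * (boxLoad x b : ℝ) ^ 2 / σ ^ 2 := fun b y x => by
    have h1 := abs_taylor_le hf hL (Z x)
      (((emptyBoxes (emptyOut b y x) : ℝ) - emptyBoxes x) / σ)
    have e : Z x + ((emptyBoxes (emptyOut b y x) : ℝ) - emptyBoxes x) / σ =
        Z (emptyOut b y x) := by rw [hZ]; ring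
    rw [e] at h1
    rw [hR]
    refine h1.trans ?_
    rw [div_pow, ← mul_div_assoc]
    have h2 := abs_emptyBoxes_emptyOut_sub_le b y x
    have h3 : ((emptyBoxes (emptyOut b y x) : ℝ) - emptyBoxes x) ^ 2 ≤ (boxLoad x b : ℝ) ^ 2 :=
      sq_le_sq' (by have := (abs_le.1 h2).1; linarith) (abs_le.1 h2).2
    gcongr
  have hRE : |𝔼 x, ∑ b, 𝔼 y, R b y x| ≤
      15 * (𝔼 x : Fin n → Fin m, ∑ b, (boxLoad x b : ℝ) ^ 2) / σ ^ 2 := by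
    rw [Finset.mul_expect, Finset.expect_div]
    refine (Finset.abs_expect_le _ _).trans (Finset.expect_le_expect fun x _ => ?_)
    rw [Finset.mul_sum, Finset.sum_div]
    refine (Finset.abs_sum_le_sum_abs _ _).trans (Finset.sum_le_sum fun b _ => ?_)
    exact (Finset.abs_expect_le _ _).trans
      (Finset.expect_le Finset.univ_nonempty fun y _ => hRb b y x)
  have hZf : 𝔼 x, Z x * f (Z x) =
      ρ / σ ^ 2 * 𝔼 x, f' (Z x) * D x + ρ / σ * 𝔼 x, ∑ b, 𝔼 y, R b y x := by
    have h1 : ∀ x, Z x * f (Z x) = (emptyBoxes x - μ) * f (Z x) / σ := fun x => by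
      rw [hZ]; ring
    have h2 : ∀ x, ∑ b, 𝔼 y, (f (Z (emptyOut b y x)) - f (Z x)) =
        f' (Z x) * D x / σ + ∑ b, 𝔼 y, R b y x := fun x => by
      rw [hD, Finset.mul_sum, Finset.sum_div, ← Finset.sum_add_distrib]
      refine Finset.sum_congr rfl fun b _ => ?_
      rw [Finset.mul_expect, Finset.expect_div, ← Finset.expect_add_distrib]
      refine Finset.expect_congr rfl fun y _ => ?_
      rw [hR]; ring
    simp_rw [h1]
    rw [← Finset.expect_div, hcov fun x => f (Z x)]
    simp_rw [h2]
    rw [Finset.expect_add_distrib, ← Finset.expect_div]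
    field_simp
  have hmain : 𝔼 x, h (Z x) - ∫ t, h t ∂(gaussianReal 0 1) =
      -(ρ / σ ^ 2 * 𝔼 x, f' (Z x) * (D x - 𝔼 z, D z)) - ρ / σ * 𝔼 x, ∑ b, 𝔼 y, R b y x := by
    have h1 : 𝔼 x, h (Z x) - ∫ t, h t ∂(gaussianReal 0 1) =
        𝔼 x, f' (Z x) - 𝔼 x, Z x * f (Z x) := by
      rw [← Finset.expect_sub_distrib]
      have : ∀ x, f' (Z x) - Z x * f (Z x) = h (Z x) - ∫ t, h t ∂(gaussianReal 0 1) :=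
        fun x => by rw [hst (Z x)]; ring
      simp_rw [this]
      rw [Finset.expect_sub_distrib, Fintype.expect_const]
    rw [h1, hZf]
    simp_rw [mul_sub]
    rw [Finset.expect_sub_distrib, ← Finset.expect_mul]
    have h2 : ρ / σ ^ 2 * 𝔼 x, D x = 1 := by
      rw [div_mul_eq_mul_div, ← hED, div_self (by positivity)]
    linear_combination (-(𝔼 x, f' (Z x))) * h2
  have hfD : |𝔼 x, f' (Z x) * (D x - 𝔼 z, D z)| ≤ 15 * 𝔼 x, |D x - 𝔼 z, D z| := by
    rw [Finset.mul_expect]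
    refine (Finset.abs_expect_le _ _).trans (Finset.expect_le_expect fun x _ => ?_)
    rw [abs_mul]
    exact mul_le_mul_of_nonneg_right (hb _) (abs_nonneg _)
  have hgoal : |𝔼 x, h (Z x) - ∫ t, h t ∂(gaussianReal 0 1)| ≤
      ρ / σ ^ 2 * (15 * 𝔼 x, |D x - 𝔼 z, D z|) +
      ρ / σ * (15 * (𝔼 x : Fin n → Fin m, ∑ b, (boxLoad x b : ℝ) ^ 2) / σ ^ 2) := by
    rw [hmain]
    refine (abs_sub _ _).trans ?_
    rw [abs_neg, abs_mul, abs_mul, abs_of_nonneg (div_nonneg hρ0 hσ.le),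
      abs_of_nonneg (div_nonneg hρ0 (sq_nonneg σ))]
    gcongr
  rw [hZ] at hgoal
  refine hgoal.trans (le_of_eq ?_)
  field_simp

/-- The distance to normality in terms of the standard deviation. -/
theorem abs_expect_sub_gaussian_le (hm : 2 ≤ m) {μ σ : ℝ} (hσ : 0 < σ)
    (hμ : μ = 𝔼 x : Fin n → Fin m, (emptyBoxes x : ℝ))
    (hv : σ ^ 2 = 𝔼 x : Fin n → Fin m, (emptyBoxes x : ℝ) ^ 2 - μ ^ 2)
    {h : ℝ → ℝ} (hh : LipschitzWith 1 h) :
    |𝔼 x : Fin n → Fin m, h ((emptyBoxes x - μ) / σ) - ∫ t, h t ∂(gaussianReal 0 1)| ≤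
      90 * n / σ ^ 3 := by
  have : NeZero m := ⟨by omega⟩
  have hm2 : (2 : ℝ) ≤ m := by exact_mod_cast hm
  have hn0 : (0 : ℝ) ≤ n := Nat.cast_nonneg n
  obtain ⟨D, hD⟩ : ∃ D : (Fin n → Fin m) → ℝ, D = fun x =>
    ∑ b, 𝔼 y, ((emptyBoxes (emptyOut b y x) : ℝ) - emptyBoxes x) := ⟨_, rfl⟩
  have hS := stein_sizeBias_bound hm hσ hμ hv D (fun x => by rw [hD]) hh
  obtain ⟨t, ht⟩ : ∃ t : ℝ, t = n / m := ⟨_, rfl⟩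
  have ht0 : 0 ≤ t := by rw [ht]; positivity
  have hDd : 𝔼 x, |D x - 𝔼 z, D z| ≤ √n * (5 + 2 * t) := by
    refine expect_abs_sub_le_of_bounded_differences (by positivity) D ?_
    rw [ht]
    exact abs_drift_update_sub_le hm D fun x => by
      rw [hD]; exact sum_expect_emptyBoxes_emptyOut_sub hm x
  have hN : 𝔼 x : Fin n → Fin m, ∑ b, (boxLoad x b : ℝ) ^ 2 ≤ n * (1 + t) := by
    rw [Finset.expect_sum_comm]
    refine (Finset.sum_le_sum fun b _ => (boxLoad_moments b).2).trans (le_of_eq ?_)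
    simp only [Finset.sum_const, Finset.card_univ, Fintype.card_fin, nsmul_eq_mul]
    rw [ht]; field_simp
  have hρ := pow_one_sub_inv_le n hm
  rw [← ht] at hρ
  have hρ0 : 0 ≤ (((m : ℝ) - 1) / m) ^ n :=
    pow_nonneg (div_nonneg (by linarith) (by linarith)) n
  have hE : Real.exp (-t) * (1 + t) ≤ 1 := by
    rw [Real.exp_neg, inv_mul_le_iff₀ (Real.exp_pos _)]
    linarith [Real.add_one_le_exp t]
  have hE0 := Real.exp_pos (-t)
  have hσn : σ ≤ √n := by
    refine Real.le_sqrt_of_sq_le ?_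
    rw [hv, hμ]
    exact variance_emptyBoxes_upper hm
  set ρ := (((m : ℝ) - 1) / m) ^ n
  have hρt : ρ * (1 + t) ≤ 1 := (mul_le_mul_of_nonneg_right hρ (by positivity)).trans hE
  have hρt' : ρ * (5 + 2 * t) ≤ 5 := by nlinarith
  -- The fluctuation error is of order `√n/σ²`; `σ ≤ √n` converts it to `n/σ³`, with constant `15 *
  -- 5`.
  have h1 : 15 * ρ * (𝔼 x, |D x - 𝔼 z, D z|) / σ ^ 2 ≤ 75 * n / σ ^ 3 := by
    calc _ ≤ 15 * ρ * (√n * (5 + 2 * t)) / σ ^ 2 := by gcongr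
      _ = 15 * (ρ * (5 + 2 * t)) * √n * σ / σ ^ 3 := by field_simp
      _ ≤ 15 * 5 * √n * √n / σ ^ 3 := by gcongr
      _ = _ := by rw [mul_assoc _ (√(n : ℝ)), Real.mul_self_sqrt hn0]; norm_num
  have h2 : 15 * ρ * (𝔼 x : Fin n → Fin m, ∑ b, (boxLoad x b : ℝ) ^ 2) / σ ^ 3 ≤
      15 * n / σ ^ 3 := by
    calc _ ≤ 15 * ρ * (n * (1 + t)) / σ ^ 3 := by gcongr
      _ = 15 * (ρ * (1 + t)) * n / σ ^ 3 := by ring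
      _ ≤ 15 * 1 * n / σ ^ 3 := by gcongr
      _ = _ := by ring
  refine hS.trans ((add_le_add h1 h2).trans (le_of_eq ?_))
  ring

/-! ### The occupancy measure -/

lemma integral_occupancyMeasure [NeZero m] (F : (Fin n → Fin m) → ℝ) :
    ∫ x, F x ∂(occupancyMeasure n m) = 𝔼 x, F x := by
  rw [occupancyMeasure, uniformOn, ProbabilityTheory.cond, Measure.restrict_univ, integral_smul_measure,
    integral_count, Fintype.expect_eq_sum_div_card, Measure.count_univ]
  simp [div_eq_inv_mul]

instance isProbabilityMeasure_occupancyMeasure [NeZero m] :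
    IsProbabilityMeasure (occupancyMeasure n m) :=
  instIsProbabilityMeasure_uniformOn_univ

lemma variance_occupancyMeasure [NeZero m] (F : (Fin n → Fin m) → ℝ) :
    variance F (occupancyMeasure n m) = 𝔼 x, F x ^ 2 - (𝔼 x, F x) ^ 2 := by
  rw [variance_eq_sub MemLp.of_discrete, integral_occupancyMeasure]
  simp only [Pi.pow_apply, integral_occupancyMeasure]

/-- Both laws have second moment at most 1, so each integral is within 1 of `h 0`. If the variance
vanishes, division by zero makes the standardised variable 0 and the bound still holds. -/
lemma abs_expect_sub_gaussian_le_two [NeZero m] (W : (Fin n → Fin m) → ℝ)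
    {h : ℝ → ℝ} (hh : LipschitzWith 1 h) :
    |𝔼 x, h ((W x - 𝔼 z, W z) / √(𝔼 x, W x ^ 2 - (𝔼 x, W x) ^ 2)) -
      ∫ t, h t ∂(gaussianReal 0 1)| ≤ 2 := by
  have h1 := hh.abs_integral_sub_le_one integrable_id_gaussianReal integrable_sq_gaussianReal
    integral_sq_gaussianReal.le
  obtain ⟨Z, hZ⟩ : ∃ Z : (Fin n → Fin m) → ℝ, Z = fun x =>
    (W x - 𝔼 z, W z) / √(𝔼 x, W x ^ 2 - (𝔼 x, W x) ^ 2) := ⟨_, rfl⟩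
  have hZm : AEMeasurable Z (occupancyMeasure n m) := Measurable.of_discrete.aemeasurable
  have : IsProbabilityMeasure ((occupancyMeasure n m).map Z) :=
    Measure.isProbabilityMeasure_map hZm
  have hZ2 : 𝔼 x, Z x ^ 2 ≤ 1 := by
    have e : ∀ x, Z x ^ 2 = (W x ^ 2 - 2 * (𝔼 z, W z) * W x + (𝔼 z, W z) ^ 2) /
        √(𝔼 x, W x ^ 2 - (𝔼 x, W x) ^ 2) ^ 2 := fun x => by
      rw [hZ, div_pow]; ring
    simp_rw [e]
    rw [← Finset.expect_div, Finset.expect_add_distrib, Finset.expect_sub_distrib,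
      ← Finset.mul_expect, Fintype.expect_const]
    have hv : 0 ≤ 𝔼 x, W x ^ 2 - (𝔼 x, W x) ^ 2 := by
      rw [← variance_occupancyMeasure]; exact variance_nonneg _ _
    rw [Real.sq_sqrt hv]
    refine div_le_one_of_le₀ (le_of_eq ?_) hv
    ring
  have h2 := hh.abs_integral_sub_le_one (μ := (occupancyMeasure n m).map Z)
    ((integrable_map_measure (by fun_prop) hZm).2 Integrable.of_finite)
    ((integrable_map_measure (by fun_prop) hZm).2 Integrable.of_finite) (by
      rw [integral_map hZm (by fun_prop), integral_occupancyMeasure]; exact hZ2)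
  rw [integral_map hZm hh.continuous.aestronglyMeasurable, integral_occupancyMeasure] at h2
  change |𝔼 x, h ((fun x => (W x - 𝔼 z, W z) / √(𝔼 x, W x ^ 2 - (𝔼 x, W x) ^ 2)) x) -
      ∫ t, h t ∂(gaussianReal 0 1)| ≤ 2
  rw [← hZ]
  rw [abs_le] at *
  constructor <;> linarith [h1.1, h1.2, h2.1, h2.2]

/-! ### The limiting variance -/

/-- The base equals `α e^(-2/α) (e^(1/α) - 1 - 1/α)`. -/
lemma occupancyFactor_base_pos {α : ℝ} (hα : 0 < α) :
    0 < α * Real.exp (-1 / α) - (1 + α) * Real.exp (-2 / α) := by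
  have h1 : Real.exp (-1 / α) = Real.exp (-2 / α) * Real.exp (1 / α) := by
    rw [← Real.exp_add]; congr 1; ring
  have h2 := Real.add_one_lt_exp (x := 1 / α) (by positivity)
  have h3 : α * (1 / α + 1) = 1 + α := by field_simp
  rw [h1, ← h3]
  have := mul_pos (mul_pos hα (Real.exp_pos (-2 / α))) (sub_pos.2 h2)
  linarith

lemma occupancyFactor_eq {α : ℝ} (hα : 0 < α) :
    occupancyFactor α =
      (√(α * Real.exp (-1 / α) - (1 + α) * Real.exp (-2 / α)) ^ 3)⁻¹ := by
  have h := (occupancyFactor_base_pos hα).le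
  rw [occupancyFactor, Real.rpow_neg h, Real.sqrt_eq_rpow, ← Real.rpow_natCast,
    ← Real.rpow_mul h]
  norm_num

theorem proposition3p2 :
    ∃ C : ℝ, 0 < C ∧ ∀ (α : ℝ) (n m : ℕ), 2 ≤ n → 2 ≤ m → α * (n : ℝ) = (m : ℝ) →
      normalDist (occupancyMeasure n m) (fun x => (emptyBoxes x : ℝ)) ≤
        ENNReal.ofReal (C * occupancyFactor α / Real.sqrt (n : ℝ)) := by
  refine ⟨270, by norm_num, fun α n m hn hm hα => ?_⟩
  have : NeZero m := ⟨by omega⟩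
  have hn2 : (2 : ℝ) ≤ n := by exact_mod_cast hn
  have hm2 : (2 : ℝ) ≤ m := by exact_mod_cast hm
  have hα' : α = m / n := by rw [← hα]; field_simp
  have hα0 : 0 < α := by rw [hα']; positivity
  rw [occupancyFactor_eq hα0]
  have hg := occupancyFactor_base_pos hα0
  obtain ⟨g, hgdef⟩ : ∃ g : ℝ, g = α * Real.exp (-1 / α) - (1 + α) * Real.exp (-2 / α) :=
    ⟨_, rfl⟩
  rw [← hgdef] at hg ⊢
  have hlow := variance_emptyBoxes_lower (n := n) (by omega) hm
  have hng : m * Real.exp (-(n / m)) - (m + n) * Real.exp (-(2 * (n / m))) = n * g := by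
    rw [hgdef, hα', show -1 / ((m : ℝ) / n) = -(n / m) by field_simp,
      show -2 / ((m : ℝ) / n) = -(2 * (n / m)) by field_simp]
    field_simp
    ring
  rw [hng] at hlow
  refine iSup₂_le fun h hh => ENNReal.ofReal_le_ofReal ?_
  rw [integral_map (Measurable.of_discrete.aemeasurable) hh.continuous.aestronglyMeasurable,
    variance_occupancyMeasure, integral_occupancyMeasure, integral_occupancyMeasure]
  obtain ⟨a, ha⟩ : ∃ a : ℝ, a = √n * √g := ⟨_, rfl⟩
  have ha0 : 0 < a := by rw [ha]; positivity
  have ha2 : a ^ 2 = n * g := by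
    rw [ha, mul_pow, Real.sq_sqrt (by linarith), Real.sq_sqrt hg.le]
  have hrhs : 270 * (√g ^ 3)⁻¹ / √n = 270 * n / a ^ 3 := by
    have h1 : √(n : ℝ) ^ 2 = n := Real.sq_sqrt (by linarith)
    have h2 : 0 < √(n : ℝ) := by positivity
    have h3 : 0 < √g := by positivity
    rw [ha]
    nth_rewrite 2 [← h1]
    field_simp
  rw [hrhs]
  rw [← ha2] at hlow
  rcases lt_or_ge a 2 with h4 | h4
  -- Here `a³ ≤ 8`, so the target `270 n/a³` exceeds 2.
  · refine (abs_expect_sub_gaussian_le_two _ hh).trans ?_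
    rw [le_div_iff₀ (by positivity)]
    have : a ^ 3 ≤ 2 ^ 3 := by gcongr
    nlinarith
  · obtain ⟨V, hV⟩ : ∃ V : ℝ, V = 𝔼 x : Fin n → Fin m, (emptyBoxes x : ℝ) ^ 2 -
        (𝔼 x : Fin n → Fin m, (emptyBoxes x : ℝ)) ^ 2 := ⟨_, rfl⟩
    rw [← hV] at hlow ⊢
    have hVa : a ^ 2 ≤ 2 * V := by nlinarith
    have hV0 : 0 < V := by nlinarith
    have hσ : 0 < √V := Real.sqrt_pos.2 hV0
    have hσ2 : √V ^ 2 = V := Real.sq_sqrt hV0.le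
    refine (abs_expect_sub_gaussian_le hm hσ rfl (by rw [hσ2, hV]) hh).trans ?_
    -- `1.42² ≥ 2` and `1.42³ ≤ 3`, whence the final constant `270 = 90 * 3`.
    have h5 : a ≤ 1.42 * √V := by
      refine (abs_le_of_sq_le_sq' ?_ (by positivity)).2
      rw [mul_pow, hσ2]
      nlinarith
    have h6 : a ^ 3 ≤ 3 * √V ^ 3 := by
      calc a ^ 3 ≤ (1.42 * √V) ^ 3 := by gcongr
        _ = 1.42 ^ 3 * √V ^ 3 := mul_pow _ _ _
        _ ≤ 3 * √V ^ 3 := by gcongr; norm_num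
    rw [div_le_div_iff₀ (by positivity) (by positivity)]
    nlinarith
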